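/- **Setting.** One unit of a divisible resource is allocated to $n$ agents. Agent $i$ has a private type $(v_i,s_i)\in[0,1]\times[0,\infty)$, drawn independently across agents from a distribution $D_i$ (value and size of one agent may be correlated). She has value $v_i$ for every amount $x_i\ge s_i$ and value $0$ for $x_i<s_i$. An allocation $x\in[0,\infty)^n$ is feasible if $\sum_i x_i\le 1$. Write $\mathrm{OPT}$ for the expected maximum welfare $\mathbb E\big[\max_x\sum_i v_i\mathbf 1[x_i\ge s_i]\big]$ over feasible $x$. In a posted-price mechanism the agents arrive in some order; each sees a menu of prices and takes an outcome maximizing her value minus the price. A pricing rule $p$ gives a price $p_i(z\mid y)\in[0,\infty]$ for outcome $z$ to agent $i$ given the partial allocation $y$ of earlier agents. We use two kinds of static, anonymous pricing rules. The *per-unit price* $q$: an agent can buy any amount $z\le\frac12$ that is still available, for $qz$ (all other outcomes cost $\infty$). The *take-it-or-leave-it price* $r$: an agent can buy the whole unit for $r$ if it is still available, or nothing for $0$. A mechanism *guarantees* welfare $w$ if, for every fixed arrival order, the sequential utility-maximizing choices can be made measurably, and for every (measurable, possibly history-dependent) tie-breaking that does not depend on the types of later agents, its expected welfare is at least $w$.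 For a type profile $\mathbf t$ write $\mathbf t(x)$ for the welfare of $x$, let $\mathcal F=\{x\in[0,\frac12]^n:\sum_i x_i\le1\}$, and put $\mathrm{opt}(\mathbf t,H)=\sup_{x\in H}\mathbf t(x)$, which is $0$ if $H=\emptyset$. Let $\mathrm{ALG}$ be a map from profiles to $\mathcal F$. A collection of pricing rules $p^{\mathbf t}$ is *$(\alpha,\beta)$-balanced with respect to $\mathrm{ALG}$* if there are sets $\mathcal F_x$, with $(y_i,x_{-i})\in\mathcal F$ for all $i$ and $y\in\mathcal F_x$, such that for all $\mathbf t$, all arrival orders and all $x\in\mathcal F$, with $x_{<i}$ denoting $x$ restricted to the agents before $i$: (a) $\sum_i p_i^{\mathbf t}(x_i\mid x_{<i})\ge\frac1\alpha\big(\mathbf t(\mathrm{ALG}(\mathbf t))-\mathrm{opt}(\mathbf t,\mathcal F_x)\big)$; (b) $\sum_i p_i^{\mathbf t}(x_i'\mid x_{<i})\le\beta\,\mathrm{opt}(\mathbf t,\mathcal F_x)$ for all $x'\in\mathcal F_x$. **Theorem.** 1. For every $\mathrm{ALG}$, the per-unit prices $q^{\mathbf t}=\mathbf t(\mathrm{ALG}(\mathbf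 t))$ are $(2,1)$-balanced with respect to $\mathrm{ALG}$; equivalently rescaled, the per-unit prices $q^{\mathbf t}=2\,\mathbf t(\mathrm{ALG}(\mathbf t))$ are $(1,2)$-balanced. 2. If $s_i\le\frac12$ almost surely for all $i$, there is a per-unit price that guarantees welfare $\frac13\mathrm{OPT}$. 3. For arbitrary sizes, there is a per-unit price or a take-it-or-leave-it price that guarantees welfare $\frac15\mathrm{OPT}$. 4. Such prices can be computed in time $\mathrm{poly}(n,1/\epsilon)$ from samples, up to an additive error $\epsilon$. The model is a real random access machine: natural-number registers with addition and truncated subtraction, real arrays with exact $+,-,\times,\div$ and comparisons, no rounding, unit cost per operation, and unit-cost access to independent samples of the type profile. There is a program that, for all $n$, $\epsilon>0$ and all samples, halts within a number of steps bounded by a polynomial in $n$ and $1/\epsilon$, and that, for all $D_1,\dots,D_n$ with $s_i\le\frac12$ almost surely, outputs with probability at least $1-\epsilon$ over the samples a per-unit price that guarantees welfare $\frac13\mathrm{OPT}-\epsilon$. There is another program with the same time bound that, for arbitrary $D_1,\dots,D_n$, outputs with probability at least $1-\epsilon$ one of the two kinds of mechanisms together with its price, such that this mechanism guarantees welfare $\frac15\mathrm{OPT}-\epsilon$.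 -/

import Mathlib

open MeasureTheory
open scoped NNReal ENNReal

noncomputable section

namespace Knapsack

/-! ## Allocation problems, pricing rules and balancedness

There are `n` agents. Every agent has the same outcome type `X`, whose null outcome is `0`;
restrictions on individual outcomes are part of the feasible set `F`. -/

/-- The total value of the outcome profile `x` under the valuation profile `v`. -/
def totalValue {n : ℕ} {X : Type*} (v : Fin n → X → ℝ) (x : Fin n → X) : ℝ :=
  ∑ i, v i (x i)

/-- The optimal welfare over the set `H` of outcome profiles (`0` if `H` is empty). -/
def optValue {n : ℕ} {X : Type*} (v : Fin n → X → ℝ) (H : Set (Fin n → X)) : ℝ :=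
  sSup (totalValue v '' H)

/-- The agents arrive in the order given by `ρ`: agent `j` arrives before agent `i` iff
`ρ j < ρ i`. This is the partial allocation that agent `i` finds on arrival: agents who came
earlier hold their outcome in `x`, all others (including `i`) hold the null outcome. -/
def earlier {n : ℕ} {X : Type*} [Zero X] (ρ : Equiv.Perm (Fin n)) (x : Fin n → X) (i : Fin n) :
    Fin n → X :=
  fun j => if ρ j < ρ i then x j else 0

/-- `p i z y` is the price of outcome `z` for agent `i`, given the partial allocation `y`. -/
abbrev PricingRule (n : ℕ) (X : Type*) := Fin n → X → (Fin n → X) → ℝ≥0∞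

open Classical in
/-- The static and anonymous pricing rule with price list `c`: the price depends neither on the
agent nor on the partial allocation, except that it is infinite if the outcome cannot feasibly
be added. -/
def staticAnonymous {n : ℕ} {X : Type*} (F : Set (Fin n → X)) (c : X → ℝ≥0∞) :
    PricingRule n X :=
  fun i z y => if Function.update y i z ∈ F then c z else ⊤

/-- `H` is exchange compatible with `x` (for the feasible set `F`): each single coordinate of `x`
can be replaced by that of any `y ∈ H`. -/
def ExchangeCompatible {n : ℕ} {X : Type*} (F : Set (Fin n → X)) (x : Fin n → X)
    (H : Set (Fin n → X)) : Prop :=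
  ∀ y ∈ H, ∀ i, Function.update x i (y i) ∈ F

/-- The pricing rule `p` is `(α, β)`-balanced for the valuation profile `v`, with respect to the
allocation `a` chosen by the allocation rule, the family `G` and the order `ρ`. -/
def IsBalanced {n : ℕ} {X : Type*} [Zero X] (α β : ℝ) (F : Set (Fin n → X))
    (v : Fin n → X → ℝ) (p : PricingRule n X) (a : Fin n → X)
    (G : (Fin n → X) → Set (Fin n → X)) (ρ : Equiv.Perm (Fin n)) : Prop :=
  ∀ x ∈ F,
    ENNReal.ofReal (1 / α * (totalValue v a - optValue v (G x))) ≤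
        ∑ i, p i (x i) (earlier ρ x i) ∧
    ∀ x' ∈ G x,
      ∑ i, p i (x' i) (earlier ρ x i) ≤ ENNReal.ofReal (β * optValue v (G x))

/-- A collection of pricing rules, one for each type profile `t`, is `(α, β)`-balanced with
respect to the allocation rule `alg`: some exchange-compatible family works for all profiles.
Here it has to work for all orders of the agents, too. -/
def IsBalancedCollection {n : ℕ} {X T : Type*} [Zero X] (α β : ℝ) (F : Set (Fin n → X))
    (val : T → X → ℝ) (p : (Fin n → T) → PricingRule n X) (alg : (Fin n → T) → Fin n → X) :
    Prop :=
  ∃ G : (Fin n → X) → Set (Fin n → X),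
    (∀ x, ExchangeCompatible F x (G x)) ∧
    ∀ t ρ, IsBalanced α β F (fun i => val (t i)) (p t) (alg t) G ρ

/-! ## The knapsack allocation problem -/

/-- The private type of an agent: a value in `[0, 1]` and a size. -/
abbrev AgentType := Set.Icc (0 : ℝ) 1 × ℝ≥0

/-- An agent with value `v` and size `s` has value `v` for receiving at least `s` units of the
resource and value `0` for receiving less. -/
def value (t : AgentType) (z : ℝ≥0) : ℝ := if t.2 ≤ z then (t.1 : ℝ) else 0

/-- Allocations of one divisible unit in which no agent receives more than `κ`. -/
def feasible (n : ℕ) (κ : ℝ≥0) : Set (Fin n → ℝ≥0) := {x | (∀ i, x i ≤ κ) ∧ ∑ i, x i ≤ 1}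

/-- The welfare of the allocation `x` for the type profile `t`. -/
def welfare {n : ℕ} (t : Fin n → AgentType) (x : Fin n → ℝ≥0) : ℝ :=
  totalValue (fun i => value (t i)) x

/-- The expected optimal welfare of the knapsack problem, for independent types `t i ∼ D i`. -/
def expectedOpt {n : ℕ} (D : Fin n → Measure AgentType) : ℝ :=
  ∫ t, optValue (fun i => value (t i)) (feasible n 1) ∂(Measure.pi D)

/-- Static anonymous price `q` per unit; every agent may buy at most half of the capacity. -/
def perUnit (n : ℕ) (q : ℝ≥0) : PricingRule n ℝ≥0 :=
  staticAnonymous (feasible n (1 / 2)) (fun z => (q : ℝ≥0∞) * (z : ℝ≥0∞))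

/-- Take-it-or-leave-it price `q` for the entire unit, which is treated as indivisible. -/
def takeItOrLeaveIt (n : ℕ) (q : ℝ≥0) : PricingRule n ℝ≥0 :=
  staticAnonymous (feasible n 1) (fun z => if z = 0 then 0 else if z = 1 then (q : ℝ≥0∞) else ⊤)

/-- The quasilinear utility of an agent of type `t` who obtains `z` at price `π`. -/
def utility (t : AgentType) (z : ℝ≥0) (π : ℝ≥0∞) : EReal := (value t z : EReal) - (π : EReal)

/-- `x` is an outcome rule of the posted-price mechanism with pricing rule `p` and arrival order
`ρ`: each agent in turn selects a utility-maximizing outcome from the menu. Ties may be broken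
arbitrarily, but the choice of an agent does not depend on the types of agents who arrive later. -/
structure IsOutcomeRule {n : ℕ} (p : PricingRule n ℝ≥0) (ρ : Equiv.Perm (Fin n))
    (x : (Fin n → AgentType) → Fin n → ℝ≥0) : Prop where
  measurable : Measurable x
  online : ∀ i t t', (∀ j, ρ j ≤ ρ i → t j = t' j) → x t i = x t' i
  maximizes : ∀ t i z,
    utility (t i) z (p i z (earlier ρ (x t) i)) ≤
      utility (t i) (x t i) (p i (x t i) (earlier ρ (x t) i))

/-- The posted-price mechanism with pricing rule `p` is well defined and has expected welfare at
least `w`, whatever the arrival order and the tie breaking. -/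
def GuaranteesWelfare {n : ℕ} (D : Fin n → Measure AgentType) (p : PricingRule n ℝ≥0) (w : ℝ) :
    Prop :=
  ∀ ρ : Equiv.Perm (Fin n),
    (∃ x, IsOutcomeRule p ρ x) ∧
    ∀ x, IsOutcomeRule p ρ x → w ≤ ∫ t, welfare t (x t) ∂(Measure.pi D)

/-! ## A real random access machine with sample access

Programs use natural-number registers (with addition and truncated subtraction) and arrays of
real numbers, indexed by natural-number expressions, with exact arithmetic and comparisons.
There is no rounding operation. The samples are independent draws of the type profile: entry
`ω k i` is the `k`-th sample of the type of agent `i`. Every read, every operation, every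
assignment and every test costs one step. -/

/-- Natural-number expressions; `reg x` is register `x`. -/
inductive NExpr where
  | const (k : ℕ)
  | reg (x : ℕ)
  | add (a b : NExpr)
  | sub (a b : NExpr)

/-- Real expressions; `arr a i` is entry `i` of array `a`, while `sampleValue k i` and
`sampleSize k i` are the value and the size in the `k`-th sample for agent `i`. -/
inductive RExpr where
  | const (c : ℚ)
  | ofNat (a : NExpr)
  | arr (a : ℕ) (i : NExpr)
  | sampleValue (k i : NExpr)
  | sampleSize (k i : NExpr)
  | add (a b : RExpr)
  | sub (a b : RExpr)
  | mul (a b : RExpr)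
  | div (a b : RExpr)

/-- Tests. -/
inductive Test where
  | leNat (a b : NExpr)
  | leReal (a b : RExpr)
  | not (b : Test)
  | and (b c : Test)

/-- Programs. A program is a fixed finite object, which does not depend on the input. -/
inductive Program where
  | skip
  | setNat (x : ℕ) (a : NExpr)
  | setReal (a : ℕ) (i : NExpr) (e : RExpr)
  | seq (P Q : Program)
  | ite (b : Test) (P Q : Program)
  | loop (b : Test) (P : Program)

/-- Memory contents. -/
structure State where
  nat : ℕ → ℕ
  real : ℕ → ℕ → ℝ

/-- The value of a natural-number expression. -/
def NExpr.eval (σ : State) : NExpr → ℕ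
  | const k => k
  | reg x => σ.nat x
  | add a b => a.eval σ + b.eval σ
  | sub a b => a.eval σ - b.eval σ

/-- The number of steps for evaluating a natural-number expression. -/
def NExpr.cost : NExpr → ℕ
  | const _ => 1
  | reg _ => 1
  | add a b => a.cost + b.cost + 1
  | sub a b => a.cost + b.cost + 1

/-- The value of a real expression (samples of agents that do not exist read as `0`, and so do
quotients with denominator `0`). -/
def RExpr.eval {n : ℕ} (ω : ℕ → Fin n → AgentType) (σ : State) : RExpr → ℝ
  | const c => c
  | ofNat a => a.eval σ
  | arr a i => σ.real a (i.eval σ)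
  | sampleValue k i => if h : i.eval σ < n then ((ω (k.eval σ) ⟨i.eval σ, h⟩).1 : ℝ) else 0
  | sampleSize k i => if h : i.eval σ < n then ((ω (k.eval σ) ⟨i.eval σ, h⟩).2 : ℝ) else 0
  | add a b => a.eval ω σ + b.eval ω σ
  | sub a b => a.eval ω σ - b.eval ω σ
  | mul a b => a.eval ω σ * b.eval ω σ
  | div a b => a.eval ω σ / b.eval ω σ

/-- The number of steps for evaluating a real expression. -/
def RExpr.cost : RExpr → ℕ
  | const _ => 1
  | ofNat a => a.cost + 1
  | arr _ i => i.cost + 1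
  | sampleValue k i => k.cost + i.cost + 1
  | sampleSize k i => k.cost + i.cost + 1
  | add a b => a.cost + b.cost + 1
  | sub a b => a.cost + b.cost + 1
  | mul a b => a.cost + b.cost + 1
  | div a b => a.cost + b.cost + 1

/-- Whether a test succeeds. -/
def Test.holds {n : ℕ} (ω : ℕ → Fin n → AgentType) (σ : State) : Test → Prop
  | leNat a b => a.eval σ ≤ b.eval σ
  | leReal a b => a.eval ω σ ≤ b.eval ω σ
  | not b => ¬ b.holds ω σ
  | and b c => b.holds ω σ ∧ c.holds ω σ

/-- The number of steps for evaluating a test. -/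
def Test.cost : Test → ℕ
  | leNat a b => a.cost + b.cost + 1
  | leReal a b => a.cost + b.cost + 1
  | not b => b.cost + 1
  | and b c => b.cost + c.cost + 1

/-- Assignment to a natural-number register. -/
def State.setNat (σ : State) (x k : ℕ) : State :=
  { σ with nat := Function.update σ.nat x k }

/-- Assignment to an array entry. -/
def State.setReal (σ : State) (a i : ℕ) (r : ℝ) : State :=
  { σ with real := Function.update σ.real a (Function.update (σ.real a) i r) }

/-- `Exec ω P σ τ T`: on the samples `ω`, program `P` started in state `σ` halts in state `τ`
after exactly `T` steps. -/
inductive Exec {n : ℕ} (ω : ℕ → Fin n → AgentType) : Program → State → State → ℕ → Prop where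
  | skip (σ : State) : Exec ω .skip σ σ 1
  | setNat (σ : State) (x : ℕ) (a : NExpr) :
      Exec ω (.setNat x a) σ (σ.setNat x (a.eval σ)) (a.cost + 1)
  | setReal (σ : State) (a : ℕ) (i : NExpr) (e : RExpr) :
      Exec ω (.setReal a i e) σ (σ.setReal a (i.eval σ) (e.eval ω σ)) (i.cost + e.cost + 1)
  | seq {P Q : Program} {σ τ υ : State} {S T : ℕ} (h₁ : Exec ω P σ τ S) (h₂ : Exec ω Q τ υ T) :
      Exec ω (.seq P Q) σ υ (S + T)
  | iteTrue {b : Test} {P Q : Program} {σ τ : State} {T : ℕ} (hb : b.holds ω σ)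
      (h : Exec ω P σ τ T) : Exec ω (.ite b P Q) σ τ (b.cost + T)
  | iteFalse {b : Test} {P Q : Program} {σ τ : State} {T : ℕ} (hb : ¬ b.holds ω σ)
      (h : Exec ω Q σ τ T) : Exec ω (.ite b P Q) σ τ (b.cost + T)
  | loopDone {b : Test} {P : Program} {σ : State} (hb : ¬ b.holds ω σ) :
      Exec ω (.loop b P) σ σ b.cost
  | loopStep {b : Test} {P : Program} {σ τ υ : State} {S T : ℕ} (hb : b.holds ω σ)
      (h₁ : Exec ω P σ τ S) (h₂ : Exec ω (.loop b P) τ υ T) :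
      Exec ω (.loop b P) σ υ (b.cost + S + T)

/-- The initial state: `n` is in register `0` and `ε` in entry `0` of array `0`; everything else
is `0`. -/
def initial (n : ℕ) (ε : ℝ) : State where
  nat := fun x => if x = 0 then n else 0
  real := fun a i => if a = 0 ∧ i = 0 then ε else 0

/-- On all inputs `n`, `ε > 0` and all samples, `P` halts within `poly (n, 1 / ε)` steps. -/
def PolyTime (P : Program) : Prop :=
  ∃ C k : ℕ, ∀ (n : ℕ) (ε : ℝ), 0 < ε → ∀ ω : ℕ → Fin n → AgentType,
    ∃ (τ : State) (T : ℕ),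
      Exec ω P (initial n ε) τ T ∧ (T : ℝ) ≤ C * ((n : ℝ) + 1 / ε + 1) ^ k

/-- The law of the samples: independent draws from the product distribution. -/
def sampleLaw {n : ℕ} (D : Fin n → Measure AgentType) [∀ i, IsProbabilityMeasure (D i)] :
    Measure (ℕ → Fin n → AgentType) :=
  Measure.infinitePi (fun _ : ℕ => Measure.pi D)

/-- Except with probability at most `ε` over the samples, the final state of `P` on input `n`, `ε`
is such that `good` holds. -/
def OutputsWhp (P : Program) {n : ℕ} (D : Fin n → Measure AgentType)
    [∀ i, IsProbabilityMeasure (D i)] (ε : ℝ) (good : State → Prop) : Prop :=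
  sampleLaw D {ω | ∃ τ T, Exec ω P (initial n ε) τ T ∧ ¬ good τ} ≤ ENNReal.ofReal ε

/-- The price that a program outputs: entry `0` of array `0`. -/
def State.price (τ : State) : ℝ≥0 := (τ.real 0 0).toNNReal

/-- The mechanism that a program outputs if it has to choose between the two kinds of mechanisms:
register `0` tells which one it is. -/
def State.mechanism (τ : State) (n : ℕ) : PricingRule n ℝ≥0 :=
  if τ.nat 0 = 0 then perUnit n τ.price else takeItOrLeaveIt n τ.price

end Knapsack

end

noncomputable section

namespace Knapsack

/-! ## Feasible allocations and optimal welfare -/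

/-! The welfare guarantees rest on scalar fixed points. Let `S y` be the expected sum of the
surpluses `(v - 2ys)⁺` of agents of size at most one half, and `L z` that of the surpluses `(v -
z)⁺` of agents with size in `(1/2, 1]`.

Lower bound (`le_integral_welfare`). Post `2y` per unit and let `P` be the probability that at most
half of the unit is sold in the end. Otherwise the payments are at least `y`. An agent who finds
half of the unit unsold has utility at least her surplus; whether she finds it depends on earlier
types only, hence is independent of her own type, and has probability at least `P`. Welfare is
payments plus utilities, so it is at least `(1 - P) y + P S y ≥ min (S y) y`. The same argument
gives `min (L z) z` for the take-it-or-leave-it price `z`.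

Upper bound (`optValue_le`). As in weak duality, each agent's value is at most her surplus plus what
her allocation costs. The amounts sum to at most one, and at most one agent receives more than half,
so `OPT ≤ S y + 2y + L z + z`.

`S` and `L` are nonincreasing and Lipschitz, so the intermediate value theorem yields `S u = u` and
`L w = w`. Then `OPT ≤ 3u + 2w`, where the larger of `u` and `w` is guaranteed by one of the two
mechanisms: this is the factor 5. If all sizes are at most one half, `L` vanishes and `w = 0`: this
is the factor 3.

Computation. A fixed point is the place where a nonincreasing function crosses the diagonal. The
program returns the first multiple of a small step at which the empirical surplus is below the
diagonal. By monotonicity, Chebyshev's inequality at just two points locates it, and the Lipschitz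
bound turns the error in the price into an error in welfare.

Balancedness is a separate, pointwise argument: an allocation that uses more than half of the
capacity has already paid half the target, and any other allocation leaves room for every single
exchange. -/

theorem value_nonneg (t : AgentType) (z : ℝ≥0) : 0 ≤ value t z := by
  unfold value
  split_ifs
  exacts [t.1.2.1, le_rfl]

theorem value_le_one (t : AgentType) (z : ℝ≥0) : value t z ≤ 1 := by
  unfold value
  split_ifs
  exacts [t.1.2.2, zero_le_one]

variable {n : ℕ}

theorem zero_mem_feasible (κ : ℝ≥0) : (0 : Fin n → ℝ≥0) ∈ feasible n κ := by
  simp [feasible]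

theorem feasible_of_le {κ : ℝ≥0} {x y : Fin n → ℝ≥0} (hx : x ∈ feasible n κ) (h : y ≤ x) :
    y ∈ feasible n κ :=
  ⟨fun i => (h i).trans (hx.1 i), (Finset.sum_le_sum fun i _ => h i).trans hx.2⟩

theorem update_le_add (x : Fin n → ℝ≥0) (i : Fin n) (z : ℝ≥0) :
    ∑ j, Function.update x i z j ≤ ∑ j, x j + z := by
  rw [Finset.sum_update_of_mem (Finset.mem_univ i), add_comm]
  gcongr
  exact Finset.sdiff_subset

theorem update_mem_feasible {κ : ℝ≥0} {x : Fin n → ℝ≥0} (hx : ∀ i, x i ≤ κ) {i : Fin n} {z : ℝ≥0}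
    (hz : z ≤ κ) (h : ∑ j, x j + z ≤ 1) : Function.update x i z ∈ feasible n κ := by
  refine ⟨fun j => ?_, (update_le_add x i z).trans h⟩
  rcases eq_or_ne j i with rfl | hj
  · simpa using hz
  · simpa [hj] using hx j

theorem earlier_le (ρ : Equiv.Perm (Fin n)) (x : Fin n → ℝ≥0) (i : Fin n) : earlier ρ x i ≤ x := by
  intro j
  unfold earlier
  split_ifs
  exacts [le_rfl, zero_le]

theorem earlier_self (ρ : Equiv.Perm (Fin n)) (x : Fin n → ℝ≥0) (i : Fin n) :
    earlier ρ x i i = 0 := by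
  simp [earlier]

theorem update_earlier_le (ρ : Equiv.Perm (Fin n)) (x : Fin n → ℝ≥0) (i : Fin n) :
    Function.update (earlier ρ x i) i (x i) ≤ x := by
  intro j
  rcases eq_or_ne j i with rfl | hj
  · simp
  · simpa [hj] using earlier_le ρ x i j

theorem totalValue_nonneg (t : Fin n → AgentType) (x : Fin n → ℝ≥0) :
    0 ≤ totalValue (fun i => value (t i)) x :=
  Finset.sum_nonneg fun _ _ => value_nonneg _ _

theorem totalValue_le (t : Fin n → AgentType) (x : Fin n → ℝ≥0) :
    totalValue (fun i => value (t i)) x ≤ n := by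
  simpa [totalValue] using Finset.sum_le_card_nsmul Finset.univ (fun i => value (t i) (x i)) 1
    fun i _ => value_le_one _ _

theorem optValue_nonneg (t : Fin n → AgentType) (H : Set (Fin n → ℝ≥0)) :
    0 ≤ optValue (fun i => value (t i)) H :=
  Real.sSup_nonneg (by rintro _ ⟨x, -, rfl⟩; exact totalValue_nonneg t x)

theorem totalValue_le_optValue (t : Fin n → AgentType) {H : Set (Fin n → ℝ≥0)} {x : Fin n → ℝ≥0}
    (hx : x ∈ H) : totalValue (fun i => value (t i)) x ≤ optValue (fun i => value (t i)) H :=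
  le_csSup ⟨n, by rintro _ ⟨y, -, rfl⟩; exact totalValue_le t y⟩ ⟨x, hx, rfl⟩

/-! ## Balancedness of per-unit prices -/

open Classical in
/-- The exchange-compatible family for per-unit prices: an allocation of at least half of the
capacity may block everything, any other allocation blocks nothing. -/
def exchangeFamily (n : ℕ) (x : Fin n → ℝ≥0) : Set (Fin n → ℝ≥0) :=
  if ∑ i, x i ≤ 1 / 2 ∧ ∀ i, x i ≤ 1 / 2 then feasible n (1 / 2) else ∅

/-- A load of at most one half plus one further amount of at most one half fits into the unit.
Compatibility is demanded for infeasible `x` too, hence the coordinatewise bound in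
`exchangeFamily`. -/
theorem exchangeCompatible_exchangeFamily (x : Fin n → ℝ≥0) :
    ExchangeCompatible (feasible n (1 / 2)) x (exchangeFamily n x) := by
  intro y hy i
  unfold exchangeFamily at hy
  split_ifs at hy with h
  · exact update_mem_feasible h.2 (hy.1 i)
      ((add_le_add h.1 (hy.1 i)).trans_eq (add_halves 1))
  · exact hy.elim

theorem perUnit_of_mem {q z : ℝ≥0} {i : Fin n} {y : Fin n → ℝ≥0}
    (h : Function.update y i z ∈ feasible n (1 / 2)) :
    perUnit n q i z y = ((q * z : ℝ≥0) : ℝ≥0∞) :=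
  (if_pos h).trans (by push_cast; rfl)

theorem sum_perUnit (q : ℝ≥0) (z y : Fin n → ℝ≥0) (ρ : Equiv.Perm (Fin n))
    (h : ∀ i, Function.update (earlier ρ y i) i (z i) ∈ feasible n (1 / 2)) :
    ∑ i, perUnit n q i (z i) (earlier ρ y i) = ((q * ∑ i, z i : ℝ≥0) : ℝ≥0∞) := by
  rw [Finset.sum_congr rfl fun i _ => perUnit_of_mem (h i), Finset.mul_sum]
  push_cast
  rfl

/-- The per-unit price of `c` times the welfare of the allocation `a` is `(2 / c, c)`-balanced. -/
theorem isBalanced_perUnit {α β c : ℝ} (hc : 0 ≤ c) (hα : 1 / α = c / 2) (hβ : β = c)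
    (t : Fin n → AgentType) {a : Fin n → ℝ≥0} (ha : a ∈ feasible n (1 / 2)) {q : ℝ≥0}
    (hq : (q : ℝ) = c * welfare t a) (ρ : Equiv.Perm (Fin n)) :
    IsBalanced α β (feasible n (1 / 2)) (fun i => value (t i)) (perUnit n q) a
      (exchangeFamily n) ρ := by
  intro x hx
  have hw : 0 ≤ welfare t a := totalValue_nonneg t a
  have key : ∀ y ∈ exchangeFamily n x, ∀ i,
      Function.update (earlier ρ x i) i (y i) ∈ feasible n (1 / 2) := fun y hy i =>
    feasible_of_le (exchangeCompatible_exchangeFamily x y hy i)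
      (update_le_update_iff.2 ⟨le_rfl, fun j _ => earlier_le ρ x i j⟩)
  constructor
  · rw [sum_perUnit q x x ρ fun i => feasible_of_le hx (update_earlier_le ρ x i),
      ← ENNReal.ofReal_coe_nnreal]
    apply ENNReal.ofReal_le_ofReal
    push_cast
    rw [hα, hq]
    change c / 2 * (welfare t a - _) ≤ _
    -- With a load of at most one half the optimum over the family is at least the welfare of `a`,
    -- so the left side is nonpositive. With a larger load the revenue alone exceeds `c / 2` times
    -- that welfare.
    by_cases h : ∑ i, x i ≤ 1 / 2
    · have : welfare t a ≤ optValue (fun i => value (t i)) (exchangeFamily n x) := by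
        rw [exchangeFamily, if_pos ⟨h, hx.1⟩]
        exact totalValue_le_optValue t ha
      have h₁ : c / 2 * (welfare t a - optValue (fun i => value (t i)) (exchangeFamily n x)) ≤ 0 :=
        mul_nonpos_of_nonneg_of_nonpos (by positivity) (by linarith)
      have h₂ : 0 ≤ c * welfare t a * ∑ i, (x i : ℝ) := by positivity
      linarith
    · have h' : (1 : ℝ) / 2 ≤ ∑ i, (x i : ℝ) := by exact_mod_cast (not_le.1 h).le
      have h₁ := optValue_nonneg t (exchangeFamily n x)
      have h₂ := mul_nonneg hc hw
      nlinarith [mul_nonneg hc h₁]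
  · intro y hy
    rw [sum_perUnit q y x ρ (key y hy), ← ENNReal.ofReal_coe_nnreal]
    apply ENNReal.ofReal_le_ofReal
    unfold exchangeFamily at hy ⊢
    split_ifs at hy ⊢ with h
    · have h₁ : welfare t a ≤ _ := totalValue_le_optValue t ha
      have h₂ : ∑ i, (y i : ℝ) ≤ 1 := by exact_mod_cast hy.2
      push_cast
      rw [hq, hβ]
      calc c * welfare t a * ∑ i, (y i : ℝ) ≤ c * welfare t a :=
            mul_le_of_le_one_right (mul_nonneg hc hw) h₂
        _ ≤ _ := mul_le_mul_of_nonneg_left h₁ hc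
    · exact hy.elim

/-! ## Utility-maximizing outcomes -/

theorem utility_coe (t : AgentType) (z π : ℝ≥0) :
    utility t z (π : ℝ≥0∞) = ((value t z - π : ℝ) : EReal) := by
  unfold utility
  rw [EReal.coe_sub]
  rfl

theorem utility_top (t : AgentType) (z : ℝ≥0) : utility t z ⊤ = ⊥ := by
  simp [utility]

theorem staticAnonymous_of_mem {F : Set (Fin n → ℝ≥0)} (c : ℝ≥0 → ℝ≥0∞) {i : Fin n} {z : ℝ≥0}
    {y : Fin n → ℝ≥0} (h : Function.update y i z ∈ F) : staticAnonymous F c i z y = c z :=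
  if_pos h

theorem staticAnonymous_of_notMem {F : Set (Fin n → ℝ≥0)} (c : ℝ≥0 → ℝ≥0∞) {i : Fin n} {z : ℝ≥0}
    {y : Fin n → ℝ≥0} (h : Function.update y i z ∉ F) : staticAnonymous F c i z y = ⊤ :=
  if_neg h

theorem earlier_eq_zero {ρ : Equiv.Perm (Fin n)} {i : Fin n} (h : (ρ i : ℕ) = 0)
    (x : Fin n → ℝ≥0) : earlier ρ x i = 0 := by
  funext j
  simp only [earlier, Fin.lt_def, h, Nat.not_lt_zero, if_false]
  rfl

theorem earlier_eq_update {ρ : Equiv.Perm (Fin n)} {i j : Fin n} (h : (ρ i : ℕ) = ρ j + 1)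
    (x : Fin n → ℝ≥0) : earlier ρ x i = Function.update (earlier ρ x j) j (x j) := by
  funext k
  rcases eq_or_ne k j with rfl | hk
  · simp [earlier, Fin.lt_def, h]
  · have : (ρ k : ℕ) ≠ ρ j := fun e => hk (ρ.injective (Fin.ext e))
    have : ρ k < ρ i ↔ ρ k < ρ j := by simp only [Fin.lt_def]; omega
    simp [earlier, hk, this]

theorem update_earlier_zero (ρ : Equiv.Perm (Fin n)) (x : Fin n → ℝ≥0) (i : Fin n) :
    Function.update (earlier ρ x i) i 0 = earlier ρ x i :=
  Function.update_eq_self_iff.2 (earlier_self ρ x i).symm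

/-- The partial allocations of a posted-price mechanism with static anonymous prices are feasible,
and no agent pays an infinite price. -/
theorem IsOutcomeRule.earlier_mem {F : Set (Fin n → ℝ≥0)} {c : ℝ≥0 → ℝ≥0∞} (hF : 0 ∈ F)
    (hc : c 0 = 0) {ρ : Equiv.Perm (Fin n)} {x : (Fin n → AgentType) → Fin n → ℝ≥0}
    (hx : IsOutcomeRule (staticAnonymous F c) ρ x) (t : Fin n → AgentType) (i : Fin n) :
    earlier ρ (x t) i ∈ F ∧ Function.update (earlier ρ (x t) i) i (x t i) ∈ F ∧
      c (x t i) ≠ ⊤ := by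
  have step : ∀ i, earlier ρ (x t) i ∈ F →
      Function.update (earlier ρ (x t) i) i (x t i) ∈ F ∧ c (x t i) ≠ ⊤ := by
    intro i hi
    -- The null outcome is free and available, so its utility is finite, whereas an infinite price
    -- gives utility `⊥`.
    have h0 := hx.maximizes t i 0
    rw [staticAnonymous_of_mem c (by rwa [update_earlier_zero]), hc, ← ENNReal.coe_zero,
      utility_coe] at h0
    constructor
    · by_contra h
      rw [staticAnonymous_of_notMem c h, utility_top] at h0
      simp at h0
    · intro h
      unfold staticAnonymous at h0
      simp only [h, ite_self, utility_top] at h0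
      simp at h0
  -- Induction along the arrival order: what the next agent finds is what the previous agent found,
  -- updated by her choice.
  suffices h : ∀ k : ℕ, ∀ i, (ρ i : ℕ) = k → earlier ρ (x t) i ∈ F from
    ⟨h _ i rfl, step i (h _ i rfl)⟩
  intro k
  induction k with
  | zero => intro i hi; rwa [earlier_eq_zero hi]
  | succ k ih =>
    intro i hi
    have hk : k < n := by have := (ρ i).2; omega
    have hj : (ρ (ρ.symm ⟨k, hk⟩) : ℕ) = k := by simp
    rw [earlier_eq_update (j := ρ.symm ⟨k, hk⟩) (by omega)]
    exact (step _ (ih _ hj)).1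

/-- The utility of an agent in the mechanism with static anonymous prices, compared with that of
any other affordable outcome. -/
theorem IsOutcomeRule.value_sub_le {F : Set (Fin n → ℝ≥0)} {c : ℝ≥0 → ℝ≥0∞} (hF : 0 ∈ F)
    (hc : c 0 = 0) {ρ : Equiv.Perm (Fin n)} {x : (Fin n → AgentType) → Fin n → ℝ≥0}
    (hx : IsOutcomeRule (staticAnonymous F c) ρ x) (t : Fin n → AgentType) (i : Fin n) {z π π' : ℝ≥0}
    (hz : Function.update (earlier ρ (x t) i) i z ∈ F) (hπ : c z = π) (hπ' : c (x t i) = π') :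
    value (t i) z - π ≤ value (t i) (x t i) - π' := by
  have h := hx.maximizes t i z
  rw [staticAnonymous_of_mem c hz, staticAnonymous_of_mem c (hx.earlier_mem hF hc t i).2.1, hπ, hπ',
    utility_coe, utility_coe] at h
  exact_mod_cast h

/-! ## Outcome rules exist -/

/-- The partial allocation after the first `k` arrivals, if each agent `i` chooses
`c i (t i) y` given the partial allocation `y`. -/
def sequential (c : Fin n → AgentType → (Fin n → ℝ≥0) → ℝ≥0) (ρ : Equiv.Perm (Fin n))
    (t : Fin n → AgentType) : ℕ → Fin n → ℝ≥0
  | 0 => 0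
  | k + 1 =>
    if h : k < n then
      Function.update (sequential c ρ t k) (ρ.symm ⟨k, h⟩)
        (c (ρ.symm ⟨k, h⟩) (t (ρ.symm ⟨k, h⟩)) (sequential c ρ t k))
    else sequential c ρ t k

section sequential

variable (c : Fin n → AgentType → (Fin n → ℝ≥0) → ℝ≥0) (ρ : Equiv.Perm (Fin n))

theorem sequential_succ (t : Fin n → AgentType) (i : Fin n) :
    sequential c ρ t (ρ i + 1) =
      Function.update (sequential c ρ t (ρ i)) i (c i (t i) (sequential c ρ t (ρ i))) := by
  simp [sequential]

theorem sequential_apply_of_lt (t : Fin n → AgentType) {i : Fin n} {k : ℕ} (h : (ρ i : ℕ) < k) :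
    sequential c ρ t k i = c i (t i) (sequential c ρ t (ρ i)) := by
  induction k with
  | zero => omega
  | succ k ih =>
    rcases (Nat.lt_succ_iff.1 h).eq_or_lt with rfl | hlt
    · rw [sequential_succ, Function.update_self]
    · rw [← ih hlt, sequential]
      split_ifs with hk
      · rw [Function.update_of_ne]
        rintro rfl
        simp at hlt
      · rfl

theorem sequential_apply_of_le (t : Fin n → AgentType) {i : Fin n} {k : ℕ} (h : k ≤ (ρ i : ℕ)) :
    sequential c ρ t k i = 0 := by
  induction k with
  | zero => rfl
  | succ k ih =>
    rw [sequential, dif_pos (by have := (ρ i).2; omega), Function.update_of_ne, ih (by omega)]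
    intro e
    have : (ρ i : ℕ) = k := by simp [e]
    omega

theorem earlier_sequential (t : Fin n → AgentType) (i : Fin n) :
    earlier ρ (sequential c ρ t n) i = sequential c ρ t (ρ i) := by
  funext j
  unfold earlier
  split_ifs with h
  · rw [sequential_apply_of_lt c ρ t (ρ j).2, sequential_apply_of_lt c ρ t h]
  · rw [sequential_apply_of_le c ρ t (not_lt.1 h)]

theorem sequential_congr {t t' : Fin n → AgentType} {k : ℕ}
    (h : ∀ j, (ρ j : ℕ) < k → t j = t' j) : sequential c ρ t k = sequential c ρ t' k := by
  induction k with
  | zero => rfl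
  | succ k ih =>
    rw [sequential, sequential, ih fun j hj => h j (by omega)]
    split_ifs with hk
    · rw [h _ (by simp)]
    · rfl

theorem measurable_sequential (hc : ∀ i, Measurable fun p : AgentType × (Fin n → ℝ≥0) => c i p.1 p.2)
    (k : ℕ) : Measurable fun t => sequential c ρ t k := by
  induction k with
  | zero => exact measurable_const
  | succ k ih =>
    simp only [sequential]
    split_ifs with hk
    · refine measurable_pi_lambda _ fun j => ?_
      rcases eq_or_ne j (ρ.symm ⟨k, hk⟩) with rfl | hj
      · simp only [Function.update_self]
        exact (hc _).comp ((measurable_pi_apply _).prodMk ih)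
      · simp only [Function.update_of_ne hj]
        exact (measurable_pi_apply j).comp ih
    · exact ih

/-- Measurable utility-maximizing choices yield an outcome rule. -/
theorem exists_isOutcomeRule {p : PricingRule n ℝ≥0}
    (hc : ∀ i, Measurable fun q : AgentType × (Fin n → ℝ≥0) => c i q.1 q.2)
    (hmax : ∀ i t y z, utility t z (p i z y) ≤ utility t (c i t y) (p i (c i t y) y)) :
    ∃ x, IsOutcomeRule p ρ x := by
  refine ⟨fun t => sequential c ρ t n, measurable_sequential c ρ hc n, fun i t t' h => ?_,
    fun t i z => ?_⟩
  · rw [sequential_apply_of_lt c ρ t (ρ i).2, sequential_apply_of_lt c ρ t' (ρ i).2, h i le_rfl,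
      sequential_congr c ρ fun j hj => h j hj.le]
  · rw [sequential_apply_of_lt c ρ t (ρ i).2, earlier_sequential]
    exact hmax i _ _ z

end sequential

theorem measurableSet_feasible (κ : ℝ≥0) : MeasurableSet (feasible n κ) := by
  have : feasible n κ = (⋂ i, {x | x i ≤ κ}) ∩ {x | ∑ i, x i ≤ 1} := by
    ext x; simp [feasible]
  rw [this]
  exact (MeasurableSet.iInter fun i => measurableSet_le (measurable_pi_apply i) measurable_const).inter
    (measurableSet_le (by fun_prop) measurable_const)

theorem measurable_value : Measurable fun p : AgentType × ℝ≥0 => value p.1 p.2 :=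
  Measurable.ite (measurableSet_le (by fun_prop) (by fun_prop)) (by fun_prop) measurable_const

theorem measurableSet_update_mem {T : Type*} [MeasurableSpace T] {κ : ℝ≥0} (i : Fin n)
    {f : T → Fin n → ℝ≥0} (hf : Measurable f) {g : T → ℝ≥0} (hg : Measurable g) :
    MeasurableSet {a | Function.update (f a) i (g a) ∈ feasible n κ} := by
  refine measurableSet_feasible κ |>.preimage (measurable_pi_lambda _ fun j => ?_)
  rcases eq_or_ne j i with rfl | hj
  · simpa using hg
  · simp only [Function.update_of_ne hj]
    exact (measurable_pi_apply j).comp hf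

theorem utility_le_of_eq_zero {κ : ℝ≥0} {c : ℝ≥0 → ℝ≥0∞} (hc : c 0 = 0) {i : Fin n}
    {t : AgentType} {y : Fin n → ℝ≥0} {z : ℝ≥0}
    (h : Function.update y i z ∈ feasible n κ → utility t z (c z) ≤ utility t 0 0) :
    utility t z (staticAnonymous (feasible n κ) c i z y) ≤
      utility t 0 (staticAnonymous (feasible n κ) c i 0 y) := by
  by_cases hz : Function.update y i z ∈ feasible n κ
  · have h0 : Function.update y i 0 ∈ feasible n κ :=
      feasible_of_le hz (update_le_update_iff.2 ⟨zero_le, fun _ _ => le_rfl⟩)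
    rw [staticAnonymous_of_mem c hz, staticAnonymous_of_mem c h0, hc]
    exact h hz
  · rw [staticAnonymous_of_notMem c hz, utility_top]
    exact bot_le

-- An explicit measurable best response: buy exactly the needed size if it is available and worth
-- its price, otherwise nothing. Anything larger costs at least as much and adds no value.
open Classical in
theorem exists_isOutcomeRule_perUnit (q : ℝ≥0) (ρ : Equiv.Perm (Fin n)) :
    ∃ x, IsOutcomeRule (perUnit n q) ρ x := by
  refine exists_isOutcomeRule (fun i t y =>
    if Function.update y i t.2 ∈ feasible n (1 / 2) ∧ (q * t.2 : ℝ) ≤ t.1 then t.2 else 0) ρ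
    (fun i => ?_) fun i t y z => ?_
  · refine Measurable.ite (MeasurableSet.inter ?_ ?_) (by fun_prop) measurable_const
    · exact measurableSet_update_mem i measurable_snd measurable_fst.snd
    · exact measurableSet_le (f := fun p : AgentType × (Fin n → ℝ≥0) => (q * p.1.2 : ℝ))
        (g := fun p => (p.1.1 : ℝ)) (by fun_prop) (by fun_prop)
  · have hq : ∀ z : ℝ≥0, (q : ℝ≥0∞) * (z : ℝ≥0∞) = ((q * z : ℝ≥0) : ℝ≥0∞) := fun z => by push_cast; rfl
    split_ifs with h
    · unfold perUnit
      rw [staticAnonymous_of_mem _ h.1]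
      by_cases hz : Function.update y i z ∈ feasible n (1 / 2)
      · rw [staticAnonymous_of_mem _ hz, hq, hq, utility_coe, utility_coe]
        have h₁ : value t t.2 = t.1 := by simp [value]
        rw [h₁, EReal.coe_le_coe_iff]
        unfold value
        push_cast
        split_ifs with hs
        · have : (q * t.2 : ℝ) ≤ q * z := by gcongr
          linarith
        · have : (0 : ℝ) ≤ q * z := by positivity
          linarith [h.2]
      · rw [staticAnonymous_of_notMem _ hz, utility_top]
        exact bot_le
    · refine utility_le_of_eq_zero (by simp) fun hz => ?_
      rw [hq, ← ENNReal.coe_zero, utility_coe, utility_coe, EReal.coe_le_coe_iff]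
      have h0 := value_nonneg t 0
      have hqz : (0 : ℝ) ≤ (q * z : ℝ≥0) := by positivity
      by_cases hs : t.2 ≤ z
      -- Since `z` is available, so is the smaller amount `t.2`; it was declined, hence it costs
      -- more than the value.
      · have hs' : Function.update y i t.2 ∈ feasible n (1 / 2) :=
          feasible_of_le hz (update_le_update_iff.2 ⟨hs, fun _ _ => le_rfl⟩)
        have h₂ : (t.1 : ℝ) < q * t.2 := not_le.1 fun h' => h ⟨hs', h'⟩
        have h₃ : (q * t.2 : ℝ) ≤ (q * z : ℝ≥0) := by push_cast; gcongr
        have h₁ : value t z = t.1 := by simp [value, hs]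
        rw [h₁]
        push_cast at h₃ ⊢
        linarith
      · have h₁ : value t z = 0 := by simp [value, hs]
        rw [h₁]
        push_cast at hqz ⊢
        linarith

-- The explicit best response here excludes size zero: such an agent already has her full value from
-- the null outcome.
open Classical in
theorem exists_isOutcomeRule_takeItOrLeaveIt (q : ℝ≥0) (ρ : Equiv.Perm (Fin n)) :
    ∃ x, IsOutcomeRule (takeItOrLeaveIt n q) ρ x := by
  refine exists_isOutcomeRule (fun i t y =>
    if Function.update y i 1 ∈ feasible n 1 ∧ t.2 ≠ 0 ∧ t.2 ≤ 1 ∧ (q : ℝ) ≤ t.1 then 1 else 0) ρ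
    (fun i => ?_) fun i t y z => ?_
  · refine Measurable.ite (MeasurableSet.inter ?_ (MeasurableSet.inter ?_ (MeasurableSet.inter ?_ ?_)))
      measurable_const measurable_const
    · exact measurableSet_update_mem i measurable_snd measurable_const
    · exact (measurableSet_eq_fun (by fun_prop) measurable_const).compl
    · exact measurableSet_le (f := fun p : AgentType × (Fin n → ℝ≥0) => p.1.2)
        (g := fun _ => 1) (by fun_prop) (by fun_prop)
    · exact measurableSet_le (f := fun _ : AgentType × (Fin n → ℝ≥0) => (q : ℝ))
        (g := fun p => (p.1.1 : ℝ)) (by fun_prop) (by fun_prop)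
  · split_ifs with h
    · unfold takeItOrLeaveIt
      rw [staticAnonymous_of_mem _ h.1]
      have h₁ : value t 1 = t.1 := by simp [value, h.2.2.1]
      have h₂ : value t 0 = 0 := by simp [value, h.2.1]
      by_cases hz : Function.update y i z ∈ feasible n 1
      · rw [staticAnonymous_of_mem _ hz]
        rw [if_neg one_ne_zero, if_pos rfl]
        split_ifs with h0 h1
        · rw [h0, ← ENNReal.coe_zero, utility_coe, utility_coe, h₁, h₂, EReal.coe_le_coe_iff]
          push_cast
          linarith [h.2.2.2]
        · rw [h1]
        · rw [utility_top]
          exact bot_le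
      · rw [staticAnonymous_of_notMem _ hz, utility_top]
        exact bot_le
    · refine utility_le_of_eq_zero (by simp) fun hz => ?_
      split_ifs with h0 h1
      · rw [h0]
      · rw [← ENNReal.coe_zero, utility_coe, utility_coe, EReal.coe_le_coe_iff]
        subst h1
        push_cast
        by_cases hs0 : t.2 = 0
        · simp [value, hs0]
        · by_cases hs1 : t.2 ≤ 1
          · have : (t.1 : ℝ) < q := not_le.1 fun h' => h ⟨hz, hs0, hs1, h'⟩
            simp only [value, hs1, if_true, le_zero_iff, hs0, if_false]
            linarith
          · simp [value, hs1, hs0]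
      · rw [utility_top]
        exact bot_le

/-! ## Surplus functions -/

/-- The surplus of an agent of size at most `1 / 2` who can buy what she needs at `2 * y` per
unit. -/
def smallSurplus (y : ℝ) (t : AgentType) : ℝ :=
  if t.2 ≤ 1 / 2 then max (t.1 - 2 * y * t.2) 0 else 0

/-- The surplus of an agent of size between `1 / 2` and `1` who can buy the entire unit for `y`. -/
def largeSurplus (y : ℝ) (t : AgentType) : ℝ :=
  if ¬ t.2 ≤ 1 / 2 ∧ t.2 ≤ 1 then max (t.1 - y) 0 else 0

/-- The properties of the surplus, as a function of the price and the type, on which the search for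
a price relies. -/
structure IsSurplus (f : ℝ → AgentType → ℝ) : Prop where
  measurable : ∀ y, Measurable (f y)
  nonneg : ∀ y t, 0 ≤ f y t
  le_one : ∀ y t, 0 ≤ y → f y t ≤ 1
  antitone : ∀ y y' t, y ≤ y' → f y' t ≤ f y t
  le_add : ∀ y y' t, y ≤ y' → f y t ≤ f y' t + (y' - y)

/-- The Lipschitz constant is 1 because the slope in `y` is at most `2s`, and `s ≤ 1 / 2`. -/
theorem isSurplus_smallSurplus : IsSurplus smallSurplus where
  measurable y := Measurable.ite (measurableSet_le (by fun_prop) (by fun_prop)) (by fun_prop)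
    measurable_const
  nonneg y t := by unfold smallSurplus; split_ifs; exacts [le_max_right _ _, le_rfl]
  le_one y t hy := by
    unfold smallSurplus
    have h₁ := t.1.2.2
    have h₂ : 0 ≤ 2 * y * t.2 := by positivity
    split_ifs
    · exact max_le (by linarith) zero_le_one
    · exact zero_le_one
  antitone y y' t h := by
    unfold smallSurplus
    split_ifs
    · gcongr
    · exact le_rfl
  le_add y y' t h := by
    unfold smallSurplus
    split_ifs with hs
    · have hs' : (t.2 : ℝ) ≤ 1 / 2 := by exact_mod_cast hs
      rw [max_add]
      apply max_le_max
      · nlinarith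
      · linarith
    · linarith

theorem isSurplus_largeSurplus : IsSurplus largeSurplus where
  measurable y := by
    refine Measurable.ite (MeasurableSet.inter (MeasurableSet.compl ?_) ?_) (by fun_prop)
      measurable_const
    · exact measurableSet_le (f := fun t : AgentType => t.2) (by fun_prop) measurable_const
    · exact measurableSet_le (f := fun t : AgentType => t.2) (by fun_prop) measurable_const
  nonneg y t := by unfold largeSurplus; split_ifs; exacts [le_max_right _ _, le_rfl]
  le_one y t hy := by
    unfold largeSurplus
    have h₁ := t.1.2.2
    split_ifs
    · exact max_le (by linarith) zero_le_one
    · exact zero_le_one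
  antitone y y' t h := by
    unfold largeSurplus
    split_ifs
    · gcongr
    · exact le_rfl
  le_add y y' t h := by
    unfold largeSurplus
    split_ifs
    · rw [max_add]
      exact max_le_max (by linarith) (by linarith)
    · linarith

/-- The expected total surplus. -/
def expectedSurplus (D : Fin n → Measure AgentType) (f : ℝ → AgentType → ℝ) (y : ℝ) : ℝ :=
  ∑ i, ∫ t, f y t ∂(D i)

section expectedSurplus

variable {f : ℝ → AgentType → ℝ} (hf : IsSurplus f) (D : Fin n → Measure AgentType)
  [∀ i, IsProbabilityMeasure (D i)]

include hf

theorem IsSurplus.integrable {y : ℝ} (hy : 0 ≤ y) (μ : Measure AgentType) [IsFiniteMeasure μ] :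
    Integrable (f y) μ :=
  Integrable.of_bound (hf.measurable y).aestronglyMeasurable 1
    (Filter.Eventually.of_forall fun t => by
      rw [Real.norm_of_nonneg (hf.nonneg y t)]; exact hf.le_one y t hy)

omit [∀ i, IsProbabilityMeasure (D i)] in
theorem IsSurplus.expectedSurplus_nonneg (y : ℝ) : 0 ≤ expectedSurplus D f y :=
  Finset.sum_nonneg fun _ _ => integral_nonneg (hf.nonneg y)

theorem IsSurplus.expectedSurplus_le {y : ℝ} (hy : 0 ≤ y) : expectedSurplus D f y ≤ n := by
  have h : ∀ i, ∫ t, f y t ∂(D i) ≤ 1 := fun i => by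
    simpa using integral_mono (hf.integrable hy (D i)) (integrable_const 1)
      (hf.le_one y · hy)
  simpa [expectedSurplus] using Finset.sum_le_card_nsmul Finset.univ _ 1 fun i _ => h i

theorem IsSurplus.expectedSurplus_antitone {y y' : ℝ} (hy : 0 ≤ y) (h : y ≤ y') :
    expectedSurplus D f y' ≤ expectedSurplus D f y :=
  Finset.sum_le_sum fun i _ => integral_mono (hf.integrable (hy.trans h) (D i))
    (hf.integrable hy (D i)) (hf.antitone y y' · h)

theorem IsSurplus.expectedSurplus_le_add {y y' : ℝ} (hy : 0 ≤ y) (h : y ≤ y') :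
    expectedSurplus D f y ≤ expectedSurplus D f y' + n * (y' - y) := by
  have key : ∀ i, ∫ t, f y t ∂(D i) ≤ ∫ t, f y' t ∂(D i) + (y' - y) := fun i => by
    have h₁ := hf.integrable (hy.trans h) (D i)
    calc ∫ t, f y t ∂(D i) ≤ ∫ t, (f y' t + (y' - y)) ∂(D i) :=
          integral_mono (hf.integrable hy (D i)) (h₁.add (integrable_const _))
            (hf.le_add y y' · h)
      _ = _ := by rw [integral_add h₁ (integrable_const _)]; simp
  calc expectedSurplus D f y ≤ ∑ i, (∫ t, f y' t ∂(D i) + (y' - y)) :=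
        Finset.sum_le_sum fun i _ => key i
    _ = _ := by simp [Finset.sum_add_distrib, expectedSurplus, mul_sub]

/-- The total surplus is continuous with values in `[0, n]`, so its graph over `[0, n]` crosses the
diagonal. -/
theorem IsSurplus.exists_expectedSurplus_eq : ∃ y, 0 ≤ y ∧ expectedSurplus D f y = y := by
  have hcont : ContinuousOn (expectedSurplus D f) (Set.Icc 0 n) := by
    refine (LipschitzOnWith.of_le_add_mul (n : ℝ≥0) fun y hy y' hy' => ?_).continuousOn
    rcases le_total y y' with h | h
    · simpa [Real.dist_eq, abs_sub_comm y, abs_of_nonneg (sub_nonneg.2 h)] using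
        hf.expectedSurplus_le_add D hy.1 h
    · have : (0 : ℝ) ≤ (n : ℝ≥0) * dist y y' := by positivity
      linarith [hf.expectedSurplus_antitone D hy'.1 h]
  have hn : (0 : ℝ) ≤ n := n.cast_nonneg
  obtain ⟨y, hy, h⟩ := intermediate_value_Icc hn (continuousOn_id.sub hcont)
    (show (0 : ℝ) ∈ _ from ⟨by simpa using hf.expectedSurplus_nonneg D 0,
      by simpa using hf.expectedSurplus_le D hn⟩)
  exact ⟨y, hy.1, (sub_eq_zero.1 h).symm⟩

end expectedSurplus

/-! ## An upper bound on the optimal welfare -/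

/-- Two amounts above one half would exceed the unit. -/
theorem card_half_lt_le {x : Fin n → ℝ≥0} (hx : ∑ i, x i ≤ 1) :
    (∑ i, if 1 / 2 < x i then (1 : ℝ) else 0) ≤ 1 := by
  by_cases h : ∃ i, 1 / 2 < x i
  · obtain ⟨i, hi⟩ := h
    rw [Finset.sum_eq_single i, if_pos hi]
    · intro j _ hj
      refine if_neg fun hj' => ?_
      have h₁ : x i + x j ≤ ∑ k, x k := by
        rw [← Finset.sum_pair hj.symm]
        exact Finset.sum_le_sum_of_subset (Finset.subset_univ _)
      have h₂ := add_lt_add hi hj'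
      rw [add_halves] at h₂
      exact absurd (h₂.trans_le (h₁.trans hx)) (lt_irrefl _)
    · simp
  · push Not at h
    rw [Finset.sum_eq_zero fun i _ => if_neg (not_lt.2 (h i))]
    exact zero_le_one

/-- Weak duality. A served small agent is charged `2y` per allocated unit, a served large agent is
charged `z`. The first charges sum to at most `2y` by capacity, the second to at most `z` since only
one agent can hold more than half. -/
theorem optValue_le {y z : ℝ} (hy : 0 ≤ y) (hz : 0 ≤ z) (t : Fin n → AgentType) :
    optValue (fun i => value (t i)) (feasible n 1) ≤
      ∑ i, smallSurplus y (t i) + 2 * y + (∑ i, largeSurplus z (t i) + z) := by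
  refine csSup_le ⟨_, 0, zero_mem_feasible 1, rfl⟩ ?_
  rintro _ ⟨x, hx, rfl⟩
  have key : ∀ i, value (t i) (x i) ≤ smallSurplus y (t i) + 2 * y * x i +
      (largeSurplus z (t i) + z * if 1 / 2 < x i then (1 : ℝ) else 0) := by
    intro i
    have h₁ := isSurplus_smallSurplus.nonneg y (t i)
    have h₂ := isSurplus_largeSurplus.nonneg z (t i)
    have h₃ : 0 ≤ 2 * y * x i := by positivity
    have h₄ : 0 ≤ z * if 1 / 2 < x i then (1 : ℝ) else 0 :=
      mul_nonneg hz (by split_ifs; exacts [zero_le_one, le_rfl])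
    by_cases hs : (t i).2 ≤ x i
    · have hv : value (t i) (x i) = (t i).1 := if_pos hs
      by_cases hs' : (t i).2 ≤ 1 / 2
      · have h₅ : smallSurplus y (t i) = max ((t i).1 - 2 * y * (t i).2) 0 := if_pos hs'
        have h₆ : 2 * y * (t i).2 ≤ 2 * y * x i := by
          have : ((t i).2 : ℝ) ≤ x i := by exact_mod_cast hs
          gcongr
        have := le_max_left ((t i).1 - 2 * y * (t i).2) 0
        linarith
      · have h₅ : largeSurplus z (t i) = max ((t i).1 - z) 0 := if_pos ⟨hs', hs.trans (hx.1 i)⟩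
        rw [if_pos ((not_le.1 hs').trans_le hs)] at h₄ ⊢
        have := le_max_left ((t i).1 - z) 0
        linarith
    · have hv : value (t i) (x i) = 0 := if_neg hs
      linarith
  have h₁ : (∑ i, (x i : ℝ)) ≤ 1 := by exact_mod_cast hx.2
  have h₂ := card_half_lt_le hx.2
  calc totalValue (fun i => value (t i)) x ≤ ∑ i, (smallSurplus y (t i) + 2 * y * x i +
      (largeSurplus z (t i) + z * if 1 / 2 < x i then (1 : ℝ) else 0)) :=
        Finset.sum_le_sum fun i _ => key i
    _ = ∑ i, smallSurplus y (t i) + 2 * y * ∑ i, (x i : ℝ) + (∑ i, largeSurplus z (t i) +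
        z * ∑ i, if 1 / 2 < x i then (1 : ℝ) else 0) := by
      simp only [Finset.sum_add_distrib, Finset.mul_sum]
    _ ≤ _ := by
      exact add_le_add (add_le_add_right (mul_le_of_le_one_right (by positivity) h₁) _)
        (add_le_add_right (mul_le_of_le_one_right hz h₂) _)

/-! ### Expectations under the product distribution -/

theorem integrable_eval {g : AgentType → ℝ} (D : Fin n → Measure AgentType)
    [∀ i, IsProbabilityMeasure (D i)] {i : Fin n} (hg : Integrable g (D i)) :
    Integrable (fun t : Fin n → AgentType => g (t i)) (Measure.pi D) :=
  (measurePreserving_eval D i).integrable_comp_of_integrable hg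

theorem integral_eval {g : AgentType → ℝ} (D : Fin n → Measure AgentType)
    [∀ i, IsProbabilityMeasure (D i)] (i : Fin n) (hg : Measurable g) :
    ∫ t : Fin n → AgentType, g (t i) ∂(Measure.pi D) = ∫ a, g a ∂(D i) := by
  rw [← (measurePreserving_eval D i).map_eq,
    integral_map (measurable_pi_apply i).aemeasurable hg.aestronglyMeasurable]

theorem IsSurplus.integrable_sum {f : ℝ → AgentType → ℝ} (hf : IsSurplus f)
    (D : Fin n → Measure AgentType) [∀ i, IsProbabilityMeasure (D i)] {y : ℝ} (hy : 0 ≤ y) :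
    Integrable (fun t : Fin n → AgentType => ∑ i, f y (t i)) (Measure.pi D) :=
  integrable_finsetSum _ fun i _ => integrable_eval D (hf.integrable hy (D i))

theorem IsSurplus.integral_sum {f : ℝ → AgentType → ℝ} (hf : IsSurplus f)
    (D : Fin n → Measure AgentType) [∀ i, IsProbabilityMeasure (D i)] {y : ℝ} (hy : 0 ≤ y) :
    ∫ t : Fin n → AgentType, ∑ i, f y (t i) ∂(Measure.pi D) = expectedSurplus D f y := by
  rw [integral_finsetSum _ fun i _ => integrable_eval D (hf.integrable hy (D i))]
  exact Finset.sum_congr rfl fun i _ => integral_eval D i (hf.measurable y)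

theorem expectedOpt_le (D : Fin n → Measure AgentType) [∀ i, IsProbabilityMeasure (D i)]
    {y z : ℝ} (hy : 0 ≤ y) (hz : 0 ≤ z) :
    expectedOpt D ≤ expectedSurplus D smallSurplus y + 2 * y +
      (expectedSurplus D largeSurplus z + z) := by
  have h₁ := isSurplus_smallSurplus.integrable_sum D hy
  have h₂ := isSurplus_largeSurplus.integrable_sum D hz
  have h₁' : Integrable (fun t : Fin n → AgentType => ∑ i, smallSurplus y (t i) + 2 * y)
      (Measure.pi D) := h₁.add (integrable_const _)
  have h₂' : Integrable (fun t : Fin n → AgentType => ∑ i, largeSurplus z (t i) + z)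
      (Measure.pi D) := h₂.add (integrable_const _)
  -- `integral_mono_of_nonneg` asks for integrability of the upper bound only, so measurability of
  -- the optimum is never needed.
  calc expectedOpt D ≤ ∫ t, (∑ i, smallSurplus y (t i) + 2 * y + (∑ i, largeSurplus z (t i) + z))
        ∂(Measure.pi D) :=
        integral_mono_of_nonneg (Filter.Eventually.of_forall fun t => optValue_nonneg t _)
          (h₁'.add h₂') (Filter.Eventually.of_forall fun t => optValue_le hy hz t)
    _ = _ := by
      rw [← isSurplus_smallSurplus.integral_sum D hy, ← isSurplus_largeSurplus.integral_sum D hz]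
      rw [integral_add h₁' h₂', integral_add h₁ (integrable_const _), integral_add h₂ (integrable_const _)]
      simp

/-- Take `z = 0`: the large surplus vanishes almost surely. -/
theorem expectedOpt_le_of_small (D : Fin n → Measure AgentType) [∀ i, IsProbabilityMeasure (D i)]
    (hD : ∀ i, ∀ᵐ t ∂(D i), t.2 ≤ 1 / 2) {y : ℝ} (hy : 0 ≤ y) :
    expectedOpt D ≤ expectedSurplus D smallSurplus y + 2 * y := by
  have h : expectedSurplus D largeSurplus 0 = 0 :=
    Finset.sum_eq_zero fun i _ => integral_eq_zero_of_ae <| (hD i).mono fun t ht =>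
      if_neg fun h => h.1 ht
  simpa [h] using expectedOpt_le D hy le_rfl

/-! ## Welfare of posted-price mechanisms -/

/-- In an online outcome rule the types of an agent and of the earlier agents are independent. -/
theorem integral_mul_eval_of_earlier (D : Fin n → Measure AgentType)
    [∀ i, IsProbabilityMeasure (D i)] (ρ : Equiv.Perm (Fin n)) (i : Fin n)
    {h : (Fin n → AgentType) → ℝ} (hm : Measurable h)
    (hh : ∀ t t', (∀ j, ρ j < ρ i → t j = t' j) → h t = h t') {g : AgentType → ℝ}
    (hg : Measurable g) :
    ∫ t, h t * g (t i) ∂(Measure.pi D) = (∫ t, h t ∂(Measure.pi D)) * ∫ a, g a ∂(D i) := by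
  classical
  have hind : ProbabilityTheory.iIndepFun (fun j (t : Fin n → AgentType) => t j) (Measure.pi D) :=
    ProbabilityTheory.iIndepFun_pi (X := fun _ => id) fun _ => aemeasurable_id
  set S : Finset (Fin n) := Finset.univ.filter fun j => ρ j < ρ i
  have hST : Disjoint S {i} := by simp [S]
  have hpair := hind.indepFun_finset S {i} hST fun j => measurable_pi_apply j
  -- `h` factors through the coordinates in `S`: filling in the others with the arbitrary type `a₀`
  -- does not change its value. Independence of disjoint blocks of coordinates then applies.
  let a₀ : AgentType := (⟨0, by simp⟩, 0)
  let E : (S → AgentType) → Fin n → AgentType := fun s j => if hj : j ∈ S then s ⟨j, hj⟩ else a₀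
  have hE : Measurable E := measurable_pi_lambda _ fun j => by
    by_cases hj : j ∈ S
    · simpa only [E, dif_pos hj] using measurable_pi_apply _
    · simpa only [E, dif_neg hj] using measurable_const
  have hcomp := hpair.comp (hm.comp hE)
    (hg.comp (measurable_pi_apply (⟨i, Finset.mem_singleton_self i⟩ : ({i} : Finset (Fin n)))))
  have e : (h ∘ E) ∘ (fun (t : Fin n → AgentType) (j : S) => t j) = h := by
    funext t
    refine hh _ _ fun j hj => ?_
    simp [E, S, hj]
  rw [e] at hcomp
  rw [← integral_eval D i hg]
  exact hcomp.integral_mul_eq_mul_integral hm.aestronglyMeasurable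
    (hg.comp (measurable_pi_apply i)).aestronglyMeasurable

open Classical in
/-- The surplus of agents who find half of the capacity, and the payments if half of the capacity
is sold, bound the welfare from below. -/
theorem le_integral_welfare (D : Fin n → Measure AgentType) [∀ i, IsProbabilityMeasure (D i)]
    {p : PricingRule n ℝ≥0} {ρ : Equiv.Perm (Fin n)} {x : (Fin n → AgentType) → Fin n → ℝ≥0}
    (hx : IsOutcomeRule p ρ x) {f : ℝ → AgentType → ℝ} (hf : IsSurplus f) {y c : ℝ} (hy : 0 ≤ y)
    (hrat : ∀ t i, c * x t i ≤ value (t i) (x t i))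
    (hsur : ∀ t i, ∑ j, earlier ρ (x t) i j ≤ 1 / 2 →
      f y (t i) + c * x t i ≤ value (t i) (x t i))
    (hpay : ∀ t, 0 ≤ c * ∑ i, (x t i : ℝ) ∧ (1 / 2 < ∑ i, x t i → y ≤ c * ∑ i, (x t i : ℝ))) :
    min (expectedSurplus D f y) y ≤ ∫ t, welfare t (x t) ∂(Measure.pi D) := by
  have hxi : ∀ i, Measurable fun t => x t i := fun i => (measurable_pi_apply i).comp hx.measurable
  -- `A i` indicates that agent `i` finds at most half sold, `B` that at most half is sold in the
  -- end. Loads only grow, so `B ≤ A i`.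
  let A : Fin n → (Fin n → AgentType) → ℝ := fun i t =>
    if ∑ j, earlier ρ (x t) i j ≤ 1 / 2 then 1 else 0
  let B : (Fin n → AgentType) → ℝ := fun t => if ∑ j, x t j ≤ 1 / 2 then 1 else 0
  have hA : ∀ i, Measurable (A i) := fun i => by
    refine Measurable.ite (measurableSet_le (Finset.measurable_sum _ fun j _ => ?_)
      measurable_const) measurable_const measurable_const
    unfold earlier
    split_ifs
    exacts [hxi j, measurable_const]
  have hB : Measurable B := Measurable.ite
    (measurableSet_le (Finset.measurable_sum _ fun j _ => hxi j) measurable_const)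
    measurable_const measurable_const
  have hA01 : ∀ i t, 0 ≤ A i t ∧ A i t ≤ 1 := fun i t => by
    simp only [A]; split_ifs <;> simp
  have hB01 : ∀ t, 0 ≤ B t ∧ B t ≤ 1 := fun t => by simp only [B]; split_ifs <;> simp
  have hAB : ∀ i t, B t ≤ A i t := fun i t => by
    by_cases h : ∑ j, x t j ≤ 1 / 2
    · have h' := (Finset.sum_le_sum fun j _ => earlier_le ρ (x t) i j).trans h
      simp only [A, B, if_pos h, if_pos h', le_refl]
    · simp only [B, if_neg h, (hA01 i t).1]
  have hAi : ∀ i, Integrable (A i) (Measure.pi D) := fun i =>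
    Integrable.of_bound (hA i).aestronglyMeasurable 1 (Filter.Eventually.of_forall fun t => by
      rw [Real.norm_of_nonneg (hA01 i t).1]; exact (hA01 i t).2)
  have hBi : Integrable B (Measure.pi D) :=
    Integrable.of_bound hB.aestronglyMeasurable 1 (Filter.Eventually.of_forall fun t => by
      rw [Real.norm_of_nonneg (hB01 t).1]; exact (hB01 t).2)
  have hAf : ∀ i, Integrable (fun t => A i t * f y (t i)) (Measure.pi D) := fun i =>
    Integrable.of_bound ((hA i).mul ((hf.measurable y).comp
      (measurable_pi_apply i))).aestronglyMeasurable 1 (Filter.Eventually.of_forall fun t => by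
      rw [Real.norm_of_nonneg (mul_nonneg (hA01 i t).1 (hf.nonneg y _))]
      exact mul_le_one₀ (hA01 i t).2 (hf.nonneg y _) (hf.le_one y _ hy))
  have hW : Integrable (fun t => welfare t (x t)) (Measure.pi D) := by
    have hm : Measurable fun t => welfare t (x t) := by
      unfold welfare totalValue
      exact Finset.measurable_sum _ fun i _ =>
        measurable_value.comp ((measurable_pi_apply i).prodMk (hxi i))
    refine Integrable.of_bound hm.aestronglyMeasurable n (Filter.Eventually.of_forall fun t => ?_)
    have h0 : 0 ≤ welfare t (x t) := totalValue_nonneg t _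
    rw [Real.norm_of_nonneg h0]
    exact totalValue_le t _
  -- Pointwise split of welfare into payments, at least `y` off `B`, and utilities, at least the
  -- surplus on `A i`.
  have hpt : ∀ t, y * (1 - B t) + ∑ i, A i t * f y (t i) ≤ welfare t (x t) := by
    intro t
    have h₁ : y * (1 - B t) ≤ c * ∑ i, (x t i : ℝ) := by
      by_cases h : ∑ j, x t j ≤ 1 / 2
      · simpa only [B, if_pos h, sub_self, mul_zero] using (hpay t).1
      · simpa only [B, if_neg h, sub_zero, mul_one] using (hpay t).2 (not_le.1 h)
    have h₂ : ∀ i, c * x t i + A i t * f y (t i) ≤ value (t i) (x t i) := fun i => by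
      by_cases h : ∑ j, earlier ρ (x t) i j ≤ 1 / 2
      · simp only [A, if_pos h]
        linarith [hsur t i h]
      · simpa only [A, if_neg h, zero_mul, add_zero] using hrat t i
    calc y * (1 - B t) + ∑ i, A i t * f y (t i)
        ≤ ∑ i, (c * x t i + A i t * f y (t i)) := by
          rw [Finset.sum_add_distrib, ← Finset.mul_sum]
          gcongr
      _ ≤ welfare t (x t) := Finset.sum_le_sum fun i _ => h₂ i
  set P := ∫ t, B t ∂(Measure.pi D)
  have hP0 : 0 ≤ P := integral_nonneg fun t => (hB01 t).1
  have hP1 : P ≤ 1 := by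
    simpa using integral_mono hBi (integrable_const 1) fun t => (hB01 t).2
  -- `B` may depend on the type of agent `i`, but `A i` does not. So the expectation of the product
  -- with `A i` factors, and only afterwards is `A i` bounded below by `B`.
  have hterm : ∀ i, P * ∫ a, f y a ∂(D i) ≤ ∫ t, A i t * f y (t i) ∂(Measure.pi D) := fun i => by
    rw [integral_mul_eval_of_earlier D ρ i (hA i) (fun t t' h => ?_) (hf.measurable y)]
    · exact mul_le_mul_of_nonneg_right (integral_mono hBi (hAi i) (hAB i))
        (integral_nonneg (hf.nonneg y))
    · have : earlier ρ (x t) i = earlier ρ (x t') i := by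
        funext j
        unfold earlier
        split_ifs with hj
        · exact hx.online j t t' fun k hk => h k (hk.trans_lt hj)
        · rfl
      simp only [A, this]
  have hi₁ : Integrable (fun t => y * (1 - B t)) (Measure.pi D) :=
    ((integrable_const 1).sub hBi).const_mul y
  have hi₂ := integrable_finsetSum Finset.univ fun i _ => hAf i
  have hfinal : y * (1 - P) + P * expectedSurplus D f y ≤ ∫ t, welfare t (x t) ∂(Measure.pi D) :=
    calc y * (1 - P) + P * expectedSurplus D f y
        ≤ y * (1 - P) + ∑ i, ∫ t, A i t * f y (t i) ∂(Measure.pi D) := by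
          rw [expectedSurplus, Finset.mul_sum]
          gcongr with i
          exact hterm i
      _ = ∫ t, (y * (1 - B t) + ∑ i, A i t * f y (t i)) ∂(Measure.pi D) := by
          rw [integral_add hi₁ hi₂, integral_const_mul, integral_finsetSum _ fun i _ => hAf i,
            integral_sub (integrable_const 1) hBi]
          simp [P]
      _ ≤ _ := integral_mono (hi₁.add hi₂) hW hpt
  have h₁ := mul_le_mul_of_nonneg_left (min_le_left (expectedSurplus D f y) y) hP0
  have h₂ := mul_le_mul_of_nonneg_left (min_le_right (expectedSurplus D f y) y) (sub_nonneg.2 hP1)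
  linarith

/-- The price is `2 * y` so that selling half of the unit earns `y`; a small agent who finds half
unsold can afford exactly her size. -/
theorem guaranteesWelfare_perUnit (D : Fin n → Measure AgentType) [∀ i, IsProbabilityMeasure (D i)]
    {y : ℝ} (hy : 0 ≤ y) {q : ℝ≥0} (hq : (q : ℝ) = 2 * y) :
    GuaranteesWelfare D (perUnit n q) (min (expectedSurplus D smallSurplus y) y) := by
  refine fun ρ => ⟨exists_isOutcomeRule_perUnit q ρ, fun x hx => ?_⟩
  have hF : (0 : Fin n → ℝ≥0) ∈ feasible n (1 / 2) := zero_mem_feasible _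
  have hc : ∀ z : ℝ≥0, (q : ℝ≥0∞) * z = ((q * z : ℝ≥0) : ℝ≥0∞) := fun z => by push_cast; rfl
  have hu : ∀ t i z, Function.update (earlier ρ (x t) i) i z ∈ feasible n (1 / 2) →
      value (t i) z - q * z ≤ value (t i) (x t i) - q * x t i := fun t i z hz => by
    have := IsOutcomeRule.value_sub_le hF (by simp) hx t i hz (hc z) (hc (x t i))
    push_cast at this
    exact this
  have hrat : ∀ t i, (q : ℝ) * x t i ≤ value (t i) (x t i) := fun t i => by
    have h := hu t i 0 (by
      rw [update_earlier_zero]; exact (IsOutcomeRule.earlier_mem hF (by simp) hx t i).1)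
    have := value_nonneg (t i) 0
    push_cast at h
    linarith
  refine le_integral_welfare D hx isSurplus_smallSurplus hy hrat (fun t i h => ?_) fun t => ?_
  · unfold smallSurplus
    split_ifs with hs
    · have h' := hu t i (t i).2 (update_mem_feasible
        (IsOutcomeRule.earlier_mem hF (by simp) hx t i).1.1 hs
        ((add_le_add h hs).trans_eq (add_halves 1)))
      rw [value, if_pos le_rfl] at h'
      rw [max_add]
      refine max_le ?_ (by linarith [hrat t i])
      rw [← hq]
      linarith
    · linarith [hrat t i]
  · refine ⟨by positivity, fun h => ?_⟩
    have h' : (1 : ℝ) / 2 < ∑ i, (x t i : ℝ) := by exact_mod_cast h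
    rw [hq]
    nlinarith

/-- Every sale is 0 or 1, so "at most half sold" means that nothing is sold, and "more than half
sold" means a payment of at least `y`. -/
theorem guaranteesWelfare_takeItOrLeaveIt (D : Fin n → Measure AgentType)
    [∀ i, IsProbabilityMeasure (D i)] {y : ℝ} (hy : 0 ≤ y) {q : ℝ≥0} (hq : (q : ℝ) = y) :
    GuaranteesWelfare D (takeItOrLeaveIt n q) (min (expectedSurplus D largeSurplus y) y) := by
  subst hq
  refine fun ρ => ⟨exists_isOutcomeRule_takeItOrLeaveIt q ρ, fun x hx => ?_⟩
  have hF : (0 : Fin n → ℝ≥0) ∈ feasible n 1 := zero_mem_feasible _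
  have hfin := IsOutcomeRule.earlier_mem hF (by simp) hx
  have h01 : ∀ t i, x t i = 0 ∨ x t i = 1 := fun t i => by
    have h := (hfin t i).2.2
    by_contra! h'
    simp [h'.1, h'.2] at h
  have hc : ∀ z : ℝ≥0, z = 0 ∨ z = 1 → (if z = 0 then (0 : ℝ≥0∞) else if z = 1 then (q : ℝ≥0∞)
      else ⊤) = ((q * z : ℝ≥0) : ℝ≥0∞) := by
    rintro z (rfl | rfl) <;> simp
  have hu : ∀ t i z, z = 0 ∨ z = 1 → Function.update (earlier ρ (x t) i) i z ∈ feasible n 1 →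
      value (t i) z - q * z ≤ value (t i) (x t i) - q * x t i := fun t i z hz hz' => by
    have := IsOutcomeRule.value_sub_le hF (by simp) hx t i hz' (hc z hz) (hc _ (h01 t i))
    push_cast at this
    exact this
  have hrat : ∀ t i, (q : ℝ) * x t i ≤ value (t i) (x t i) := fun t i => by
    have h := hu t i 0 (Or.inl rfl) (by rw [update_earlier_zero]; exact (hfin t i).1)
    have := value_nonneg (t i) 0
    push_cast at h
    linarith
  have hone : ∀ {a : Fin n → ℝ≥0}, (∀ i, a i = 0 ∨ a i = 1) → ∀ i, a i ≠ 0 → 1 ≤ ∑ j, a j :=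
    fun {a} ha i hi => ((ha i).resolve_left hi).ge.trans
      (Finset.single_le_sum (fun j _ => zero_le) (Finset.mem_univ i))
  refine le_integral_welfare D hx isSurplus_largeSurplus hy hrat (fun t i h => ?_) fun t => ?_
  · unfold largeSurplus
    split_ifs with hs
    · have hz : earlier ρ (x t) i = 0 := by
        by_contra hne
        obtain ⟨j, hj⟩ := Function.ne_iff.1 hne
        have h' := hone (a := earlier ρ (x t) i) (fun k => by
          unfold earlier; split_ifs; exacts [h01 t k, Or.inl rfl]) j hj
        exact absurd (h'.trans h) (not_le.2 (NNReal.half_lt_self one_ne_zero))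
      have h' := hu t i 1 (Or.inr rfl) (by
        rw [hz]
        exact update_mem_feasible (fun _ => zero_le) le_rfl (by simp))
      rw [value, if_pos hs.2] at h'
      rw [max_add]
      refine max_le ?_ (by linarith [hrat t i])
      push_cast at h'
      linarith
    · linarith [hrat t i]
  · refine ⟨by positivity, fun h => ?_⟩
    obtain ⟨i, -, hi⟩ := Finset.exists_ne_zero_of_sum_ne_zero ((zero_le.trans_lt h).ne')
    have h' : (1 : ℝ) ≤ ∑ i, (x t i : ℝ) := by exact_mod_cast hone (h01 t) i hi
    exact le_mul_of_one_le_right q.2 h'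

theorem GuaranteesWelfare.mono {D : Fin n → Measure AgentType} {p : PricingRule n ℝ≥0} {w w' : ℝ}
    (h : GuaranteesWelfare D p w) (hw : w' ≤ w) : GuaranteesWelfare D p w' :=
  fun ρ => ⟨(h ρ).1, fun x hx => hw.trans ((h ρ).2 x hx)⟩

/-! ## Estimating the surplus from samples -/

/-- The total surplus in the first `M` samples. -/
def sampleSurplus (f : ℝ → AgentType → ℝ) (M : ℕ) (y : ℝ) (ω : ℕ → Fin n → AgentType) : ℝ :=
  ∑ k ∈ Finset.range M, ∑ i, f y (ω k i)

theorem IsSurplus.sampleSurplus_antitone {f : ℝ → AgentType → ℝ} (hf : IsSurplus f) (M : ℕ)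
    {y y' : ℝ} (h : y ≤ y') (ω : ℕ → Fin n → AgentType) :
    sampleSurplus f M y' ω ≤ sampleSurplus f M y ω :=
  Finset.sum_le_sum fun _ _ => Finset.sum_le_sum fun _ _ => hf.antitone _ _ _ h

theorem IsSurplus.sampleSurplus_le {f : ℝ → AgentType → ℝ} (hf : IsSurplus f) (M : ℕ) {y : ℝ}
    (hy : 0 ≤ y) (ω : ℕ → Fin n → AgentType) : sampleSurplus f M y ω ≤ M * n := by
  calc sampleSurplus f M y ω ≤ ∑ k ∈ Finset.range M, ∑ _i : Fin n, (1 : ℝ) :=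
        Finset.sum_le_sum fun _ _ => Finset.sum_le_sum fun _ _ => hf.le_one _ _ hy
    _ = M * n := by simp

/-- Chebyshev's inequality. The surplus of one sampled profile lies in `[0, n]`, so its variance is
at most `(n / 2) ^ 2`, and variances of independent samples add up. -/
theorem IsSurplus.measure_sampleSurplus_le {f : ℝ → AgentType → ℝ} (hf : IsSurplus f)
    (D : Fin n → Measure AgentType) [∀ i, IsProbabilityMeasure (D i)] {y : ℝ} (hy : 0 ≤ y) {M : ℕ}
    (hM : 0 < M) {δ : ℝ} (hδ : 0 < δ) :
    sampleLaw D {ω | M * δ ≤ |sampleSurplus f M y ω - M * expectedSurplus D f y|} ≤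
      ENNReal.ofReal (n ^ 2 / (4 * M * δ ^ 2)) := by
  let g : (Fin n → AgentType) → ℝ := fun t => ∑ i, f y (t i)
  have hg : Measurable g := Finset.measurable_sum _ fun i _ =>
    (hf.measurable y).comp (measurable_pi_apply i)
  have hg01 : ∀ t, g t ∈ Set.Icc 0 (n : ℝ) := fun t =>
    ⟨Finset.sum_nonneg fun i _ => hf.nonneg _ _, by
      simpa using Finset.sum_le_card_nsmul Finset.univ (fun i => f y (t i)) 1
        fun i _ => hf.le_one _ _ hy⟩
  have : IsProbabilityMeasure (sampleLaw D) := by unfold sampleLaw; infer_instance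
  let X : ℕ → (ℕ → Fin n → AgentType) → ℝ := fun k ω => g (ω k)
  have hX : ∀ k, Measurable (X k) := fun k => hg.comp (measurable_pi_apply k)
  have hL : ∀ k, MemLp (X k) 2 (sampleLaw D) := fun k =>
    MemLp.of_bound (hX k).aestronglyMeasurable n (Filter.Eventually.of_forall fun ω => by
      rw [Real.norm_of_nonneg (hg01 _).1]; exact (hg01 _).2)
  have hind : ProbabilityTheory.iIndepFun X (sampleLaw D) :=
    ProbabilityTheory.iIndepFun_infinitePi (X := fun _ => g) fun _ => hg
  have hEX : ∀ k, ∫ ω, X k ω ∂(sampleLaw D) = expectedSurplus D f y := fun k => by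
    have hmp := measurePreserving_eval_infinitePi (fun _ : ℕ => Measure.pi D) k
    rw [← hf.integral_sum D hy, ← hmp.map_eq,
      integral_map (measurable_pi_apply k).aemeasurable hg.aestronglyMeasurable]
    rfl
  have hS : sampleSurplus f M y = ∑ k ∈ Finset.range M, X k := by
    funext ω; simp [sampleSurplus, X, g]
  have hES : ∫ ω, sampleSurplus f M y ω ∂(sampleLaw D) = M * expectedSurplus D f y := by
    simp only [hS, Finset.sum_apply]
    rw [integral_finsetSum _ fun k _ => (hL k).integrable one_le_two]
    simp [hEX]
  have hvark : ∀ k, ProbabilityTheory.variance (X k) (sampleLaw D) ≤ ((n : ℝ) / 2) ^ 2 := fun k => by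
    have h := ProbabilityTheory.variance_le_sq_of_bounded (μ := sampleLaw D)
      (Filter.Eventually.of_forall fun ω => hg01 (ω k)) (hX k).aemeasurable
    rwa [sub_zero] at h
  have hvar : ProbabilityTheory.variance (sampleSurplus f M y) (sampleLaw D) ≤ M * (n / 2) ^ 2 := by
    rw [hS, ProbabilityTheory.IndepFun.variance_sum (fun k _ => hL k)
      fun i _ j _ hij => hind.indepFun hij]
    calc _ ≤ ∑ _k ∈ Finset.range M, ((n : ℝ) / 2) ^ 2 := Finset.sum_le_sum fun k _ => hvark k
      _ = _ := by simp
  have hM' : (0 : ℝ) < M := by exact_mod_cast hM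
  have h := ProbabilityTheory.meas_ge_le_variance_div_sq (μ := sampleLaw D)
    (X := sampleSurplus f M y) (hS ▸ memLp_finsetSum' _ fun k _ => hL k) (mul_pos hM' hδ)
  rw [hES] at h
  refine h.trans (ENNReal.ofReal_le_ofReal ?_)
  calc _ ≤ M * ((n : ℝ) / 2) ^ 2 / (M * δ) ^ 2 := by gcongr
    _ = _ := by field_simp; ring

/-- The comparison of the empirical surplus with `y` locates the fixed point `u` of the expected
surplus up to `δ`. -/
def Separates (f : ℝ → AgentType → ℝ) (M : ℕ) (u δ : ℝ) (ω : ℕ → Fin n → AgentType) : Prop :=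
  ∀ y, 0 ≤ y → (sampleSurplus f M y ω ≤ M * y → u - δ < y) ∧
    (M * y < sampleSurplus f M y ω → y < u + δ)

/-- Empirical and expected surplus are both nonincreasing in the price, so a deviation below `M * δ`
at `u - δ` and at `u + δ` decides the comparison for all prices beyond these two points. -/
theorem IsSurplus.measure_not_separates_le {f : ℝ → AgentType → ℝ} (hf : IsSurplus f)
    (D : Fin n → Measure AgentType) [∀ i, IsProbabilityMeasure (D i)] {u : ℝ} (hu : 0 ≤ u)
    (hfix : expectedSurplus D f u = u) {M : ℕ} (hM : 0 < M) {δ : ℝ} (hδ : 0 < δ) :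
    sampleLaw D {ω | ¬ Separates f M u δ ω} ≤ ENNReal.ofReal (n ^ 2 / (2 * M * δ ^ 2)) := by
  have hM' : (0 : ℝ) < M := by exact_mod_cast hM
  -- Surplus is bounded by 1 only at nonnegative prices. If `u - δ < 0`, the lower claim is trivial
  -- and the value at `b` is not used.
  set b := max (u - δ) 0
  have hb : 0 ≤ b := le_max_right _ _
  have hbu : b ≤ u := max_le (by linarith) hu
  have ha : 0 ≤ u + δ := by positivity
  calc sampleLaw D {ω | ¬ Separates f M u δ ω}
      ≤ sampleLaw D ({ω | M * δ ≤ |sampleSurplus f M b ω - M * expectedSurplus D f b|} ∪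
          {ω | M * δ ≤ |sampleSurplus f M (u + δ) ω - M * expectedSurplus D f (u + δ)|}) := by
        refine measure_mono fun ω hω => ?_
        by_contra h
        simp only [Set.mem_union, Set.mem_ofPred_eq, not_or, not_le, abs_lt] at h
        refine hω fun y hy => ⟨fun h₁ => ?_, fun h₁ => ?_⟩
        · by_contra! h₂
          have hbe : b = u - δ := max_eq_left (hy.trans h₂)
          have h₃ := hf.sampleSurplus_antitone M h₂ ω
          have h₄ := mul_le_mul_of_nonneg_left (hf.expectedSurplus_antitone D hb hbu) hM'.le
          have h₅ := mul_le_mul_of_nonneg_left h₂ hM'.le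
          rw [hfix] at h₄
          have := h.1.1
          rw [hbe] at this h₄
          linarith
        · by_contra! h₂
          have h₃ := hf.sampleSurplus_antitone M h₂ ω
          have h₄ := mul_le_mul_of_nonneg_left
            (hf.expectedSurplus_antitone D hu (le_add_of_nonneg_right hδ.le)) hM'.le
          have h₅ := mul_le_mul_of_nonneg_left h₂ hM'.le
          rw [hfix] at h₄
          have := h.2.2
          linarith
    _ ≤ _ := measure_union_le _ _
    _ ≤ ENNReal.ofReal (n ^ 2 / (4 * M * δ ^ 2)) + ENNReal.ofReal (n ^ 2 / (4 * M * δ ^ 2)) :=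
        add_le_add (hf.measure_sampleSurplus_le D hb hM hδ) (hf.measure_sampleSurplus_le D ha hM hδ)
    _ = _ := by
        rw [← ENNReal.ofReal_add (by positivity) (by positivity)]
        congr 1
        field_simp
        ring

/-- `g` is the first multiple of `δ` that passes the comparison with the empirical surplus. -/
def IsFirst (f : ℝ → AgentType → ℝ) (M : ℕ) (δ : ℝ) (ω : ℕ → Fin n → AgentType) (g : ℕ) : Prop :=
  sampleSurplus f M (g * δ) ω ≤ M * (g * δ) ∧
    ∀ j < g, ¬ sampleSurplus f M (j * δ) ω ≤ M * (j * δ)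

/-- The first accepted candidate exceeds `u - δ`; its predecessor was rejected, so it is below `u +
δ`, and one step is added. -/
theorem Separates.abs_sub_le {f : ℝ → AgentType → ℝ} {M : ℕ} {u δ : ℝ} (hu : 0 ≤ u) (hδ : 0 < δ)
    {ω : ℕ → Fin n → AgentType} (h : Separates f M u δ ω) {g : ℕ} (hg : IsFirst f M δ ω g) :
    |g * δ - u| ≤ 2 * δ := by
  have h₁ := (h (g * δ) (by positivity)).1 hg.1
  rw [abs_le]
  refine ⟨by linarith, ?_⟩
  rcases Nat.eq_zero_or_pos g with rfl | hpos
  · simp only [CharP.cast_eq_zero, zero_mul]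
    linarith
  · obtain ⟨j, rfl⟩ := Nat.exists_eq_succ_of_ne_zero hpos.ne'
    have h₂ := (h (j * δ) (by positivity)).2 (not_le.1 (hg.2 j j.lt_succ_self))
    push_cast
    linarith

/-- Below the fixed point the surplus is at least `u` by monotonicity; above it the Lipschitz bound
loses at most `n * e`. -/
theorem IsSurplus.sub_le_min {f : ℝ → AgentType → ℝ} (hf : IsSurplus f)
    (D : Fin n → Measure AgentType) [∀ i, IsProbabilityMeasure (D i)] {u y e : ℝ} (hu : 0 ≤ u)
    (hfix : expectedSurplus D f u = u) (hy : 0 ≤ y) (h : |y - u| ≤ e) :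
    u - (n + 1) * e ≤ min (expectedSurplus D f y) y := by
  have he := abs_nonneg _ |>.trans h
  have hne : 0 ≤ n * e := by positivity
  rw [abs_le] at h
  refine le_min ?_ (by linarith)
  rcases le_total y u with hyu | hyu
  · have := hf.expectedSurplus_antitone D hy hyu
    linarith
  · have h₁ := hf.expectedSurplus_le_add D hu hyu
    have h₂ : (n : ℝ) * (y - u) ≤ n * e := by gcongr; exact h.2
    linarith

/-! ## Execution of programs -/

/-- Started in `σ`, the program halts within `B` steps in a state that satisfies `Q`. -/
def Halts (ω : ℕ → Fin n → AgentType) (P : Program) (σ : State) (Q : State → Prop) (B : ℕ) : Prop :=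
  ∃ τ T, Exec ω P σ τ T ∧ Q τ ∧ T ≤ B

section Halts

variable {ω : ℕ → Fin n → AgentType} {P P' : Program} {σ : State} {Q R : State → Prop} {B B' : ℕ}

theorem Halts.mono (h : Halts ω P σ Q B) (hQ : ∀ τ, Q τ → R τ) (hB : B ≤ B') : Halts ω P σ R B' := by
  obtain ⟨τ, T, h₁, h₂, h₃⟩ := h
  exact ⟨τ, T, h₁, hQ τ h₂, h₃.trans hB⟩

theorem Halts.seq (h : Halts ω P σ Q B) (h' : ∀ τ, Q τ → Halts ω P' τ R B') :
    Halts ω (.seq P P') σ R (B + B') := by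
  obtain ⟨τ, T, h₁, h₂, h₃⟩ := h
  obtain ⟨υ, S, k₁, k₂, k₃⟩ := h' τ h₂
  exact ⟨υ, T + S, h₁.seq k₁, k₂, add_le_add h₃ k₃⟩

theorem halts_setNat {x : ℕ} {a : NExpr} (h : Q (σ.setNat x (a.eval σ))) :
    Halts ω (.setNat x a) σ Q (a.cost + 1) :=
  ⟨_, _, .setNat σ x a, h, le_rfl⟩

theorem halts_setReal {a : ℕ} {i : NExpr} {e : RExpr}
    (h : Q (σ.setReal a (i.eval σ) (e.eval ω σ))) :
    Halts ω (.setReal a i e) σ Q (i.cost + e.cost + 1) :=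
  ⟨_, _, .setReal σ a i e, h, le_rfl⟩

theorem halts_skip (h : Q σ) : Halts ω .skip σ Q 1 :=
  ⟨_, _, .skip σ, h, le_rfl⟩

theorem halts_ite {b : Test} (h : b.holds ω σ → Halts ω P σ Q B)
    (h' : ¬ b.holds ω σ → Halts ω P' σ Q B') : Halts ω (.ite b P P') σ Q (b.cost + (B + B')) := by
  by_cases hb : b.holds ω σ
  · obtain ⟨τ, T, h₁, h₂, h₃⟩ := h hb
    exact ⟨τ, _, .iteTrue hb h₁, h₂, by omega⟩
  · obtain ⟨τ, T, h₁, h₂, h₃⟩ := h' hb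
    exact ⟨τ, _, .iteFalse hb h₁, h₂, by omega⟩

/-- A loop with invariant `I j` before iteration `j`, which ends after `N` iterations. -/
theorem halts_loop {b : Test} (I : ℕ → State → Prop) {N : ℕ} (h0 : I 0 σ)
    (hstep : ∀ j < N, ∀ τ, I j τ → b.holds ω τ ∧ Halts ω P τ (I (j + 1)) B)
    (hend : ∀ τ, I N τ → ¬ b.holds ω τ) :
    Halts ω (.loop b P) σ (I N) (N * (b.cost + B) + b.cost) := by
  suffices h : ∀ k j, j + k = N → ∀ τ, I j τ →
      Halts ω (.loop b P) τ (I N) (k * (b.cost + B) + b.cost) from h N 0 (by omega) σ h0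
  intro k
  induction k with
  | zero =>
    rintro j rfl τ hτ
    exact ⟨τ, _, .loopDone (hend τ hτ), hτ, by omega⟩
  | succ k ih =>
    intro j hj τ hτ
    obtain ⟨hb, υ, T, h₁, h₂, h₃⟩ := hstep j (by omega) τ hτ
    obtain ⟨φ, S, k₁, k₂, k₃⟩ := ih (j + 1) (by omega) υ h₂
    exact ⟨φ, _, .loopStep hb h₁ k₁, k₂, by rw [Nat.succ_mul]; omega⟩

/-- `OutputsWhp` counts a sample as bad as soon as some halting execution is bad; determinism makes
it enough to exhibit one good execution. -/
theorem exec_unique {τ τ' : State} {T T' : ℕ} (h : Exec ω P σ τ T) (h' : Exec ω P σ τ' T') :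
    τ = τ' := by
  induction h generalizing τ' T' with
  | skip => cases h'; rfl
  | setNat => cases h'; rfl
  | setReal => cases h'; rfl
  | seq _ _ ih₁ ih₂ =>
    cases h' with
    | seq k₁ k₂ => obtain rfl := ih₁ k₁; exact ih₂ k₂
  | iteTrue hb _ ih =>
    cases h' with
    | iteTrue _ k => exact ih k
    | iteFalse hb' _ => exact absurd hb hb'
  | iteFalse hb _ ih =>
    cases h' with
    | iteTrue hb' _ => exact absurd hb' hb
    | iteFalse _ k => exact ih k
  | loopDone hb =>
    cases h' with
    | loopDone _ => rfl
    | loopStep hb' _ _ => exact absurd hb' hb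
  | loopStep hb _ _ ih₁ ih₂ =>
    cases h' with
    | loopDone hb' => exact absurd hb hb'
    | loopStep _ k₁ k₂ => obtain rfl := ih₁ k₁; exact ih₂ k₂

end Halts

theorem outputsWhp_of_halts {P : Program} {D : Fin n → Measure AgentType}
    [∀ i, IsProbabilityMeasure (D i)] {ε : ℝ} {good : State → Prop}
    {bad : Set (ℕ → Fin n → AgentType)} (hbad : sampleLaw D bad ≤ ENNReal.ofReal ε)
    (h : ∀ ω ∉ bad, ∃ B, Halts ω P (initial n ε) good B) : OutputsWhp P D ε good := by
  refine (measure_mono ?_).trans hbad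
  rintro ω ⟨τ, T, hτ, hgood⟩
  by_contra hω
  obtain ⟨-, τ', T', h₁, h₂, -⟩ := h ω hω
  exact hgood (exec_unique hτ h₁ ▸ h₂)

/-! ## The search for a price

Register `1` holds the number `g` of the current candidate, register `2` the number of the current
sample and register `3` that of the current agent. Entry `0` of array `1` accumulates the surplus.
Register `4` is not touched. -/

/-- The distance of successive candidates. -/
def stepSize (n : ℕ) (ε : ℝ) : ℝ := ε / (8 * (n + 1))

/-- The number of samples. -/
def sampleCount (n : ℕ) (ε : ℝ) : ℕ := ⌈64 * ((n + 1 : ℝ) * (n + 1)) * ((n + 1) * (n + 1)) /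
  (ε * ε * ε)⌉₊

theorem stepSize_pos (n : ℕ) {ε : ℝ} (hε : 0 < ε) : 0 < stepSize n ε := by
  unfold stepSize; positivity

theorem sampleCount_pos (n : ℕ) {ε : ℝ} (hε : 0 < ε) : 0 < sampleCount n ε :=
  Nat.ceil_pos.2 (by positivity)

/-- The expression `n + 1`. -/
def succExpr : RExpr := .add (.ofNat (.reg 0)) (.const 1)

/-- The expression `ε`. -/
def epsExpr : RExpr := .arr 0 (.const 0)

/-- The expression `stepSize n ε`. -/
def stepExpr : RExpr := .div epsExpr (.mul (.const 8) succExpr)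

/-- The candidate whose number is in register `r`. -/
def candidateExpr (r : ℕ) : RExpr := .mul (.ofNat (.reg r)) stepExpr

/-- The real number whose ceiling is `sampleCount n ε`. -/
def countExpr : RExpr :=
  .div (.mul (.mul (.const 64) (.mul succExpr succExpr)) (.mul succExpr succExpr))
    (.mul (.mul epsExpr epsExpr) epsExpr)

/-- Increment of register `r`. -/
def increment (r : ℕ) : Program := .setNat r (.add (.reg r) (.const 1))

/-- Adds up the surplus of all agents in the current sample. -/
def sumAgents (b : Test) (e : RExpr) : Program :=
  .loop (.not (.leNat (.reg 0) (.reg 3)))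
    (.seq (.ite b (.setReal 1 (.const 0) (.add (.arr 1 (.const 0)) e)) .skip) (increment 3))

/-- Adds up the surplus of all agents in all samples. -/
def sumSamples (b : Test) (e : RExpr) : Program :=
  .seq (.setNat 2 (.const 0)) (.seq (.setReal 1 (.const 0) (.const 0))
    (.loop (.not (.leReal countExpr (.ofNat (.reg 2))))
      (.seq (.setNat 3 (.const 0)) (.seq (sumAgents b e) (increment 2)))))

/-- Searches for the first candidate that is at least the average surplus. -/
def search (b : Test) (e : RExpr) : Program :=
  .seq (.setNat 1 (.const 0)) (.seq (sumSamples b e)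
    (.loop (.not (.leReal (.arr 1 (.const 0)) (.mul (.ofNat (.reg 2)) (candidateExpr 1))))
      (.seq (increment 1) (sumSamples b e))))

/-- The input and the number `g` of the candidate are in place, and register `4` holds `s`. -/
structure Memory (n : ℕ) (ε : ℝ) (s g : ℕ) (σ : State) : Prop where
  agents : σ.nat 0 = n
  eps : σ.real 0 0 = ε
  saved : σ.nat 4 = s
  candidate : σ.nat 1 = g

section Memory

variable {n : ℕ} {ε : ℝ} {s g : ℕ} {σ : State}

theorem Memory.setNat (h : Memory n ε s g σ) {x : ℕ} (k : ℕ) (h0 : 0 ≠ x) (h1 : 1 ≠ x)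
    (h4 : 4 ≠ x) : Memory n ε s g (σ.setNat x k) where
  agents := (Function.update_of_ne h0 _ _).trans h.agents
  eps := h.eps
  saved := (Function.update_of_ne h4 _ _).trans h.saved
  candidate := (Function.update_of_ne h1 _ _).trans h.candidate

theorem Memory.setReal (h : Memory n ε s g σ) (r : ℝ) : Memory n ε s g (σ.setReal 1 0 r) where
  agents := h.agents
  eps := by simpa [State.setReal] using h.eps
  saved := h.saved
  candidate := h.candidate

variable (ω : ℕ → Fin n → AgentType)

theorem Memory.eval_stepExpr (h : Memory n ε s g σ) : stepExpr.eval ω σ = stepSize n ε := by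
  simp [stepExpr, epsExpr, succExpr, RExpr.eval, NExpr.eval, h.agents, h.eps, stepSize]

theorem Memory.eval_candidateExpr (h : Memory n ε s g σ) (r : ℕ) :
    (candidateExpr r).eval ω σ = σ.nat r * stepSize n ε := by
  simp [candidateExpr, RExpr.eval, NExpr.eval, h.eval_stepExpr]

/-- A loop can thus run up to a ceiling on a machine that cannot round: it compares its integer
counter with the real number itself. -/
theorem Memory.countExpr_le_iff (h : Memory n ε s g σ) (k : ℕ) :
    countExpr.eval ω σ ≤ k ↔ sampleCount n ε ≤ k := by
  simp [countExpr, epsExpr, succExpr, RExpr.eval, NExpr.eval, h.agents, h.eps, sampleCount]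

end Memory

/-- If the test `b` succeeds, the expression `e` yields the surplus `f` of the current agent in the
current sample for the current candidate; otherwise this surplus is `0`. -/
def Implements (b : Test) (e : RExpr) (f : ℝ → AgentType → ℝ) : Prop :=
  ∀ {n : ℕ} {ε : ℝ} {s g : ℕ} {σ : State} (ω : ℕ → Fin n → AgentType) (i : Fin n),
    Memory n ε s g σ → σ.nat 3 = i →
      (b.holds ω σ → e.eval ω σ = f (g * stepSize n ε) (ω (σ.nat 2) i)) ∧
      (¬ b.holds ω σ → f (g * stepSize n ε) (ω (σ.nat 2) i) = 0)

section search

variable {b : Test} {e : RExpr} {f : ℝ → AgentType → ℝ}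

theorem halts_sumAgents (hbe : Implements b e f) : ∃ c : ℕ, ∀ {n : ℕ} {ε : ℝ} {s g : ℕ} {σ : State}
    (ω : ℕ → Fin n → AgentType), Memory n ε s g σ → σ.nat 3 = 0 →
      Halts ω (sumAgents b e) σ (fun τ => Memory n ε s g τ ∧ τ.nat 2 = σ.nat 2 ∧
        τ.real 1 0 = σ.real 1 0 + ∑ i, f (g * stepSize n ε) (ω (σ.nat 2) i)) (c * (n + 1)) := by
  -- Steps per iteration: 4 for the loop test, 4 for the increment, and in between the conditional,
  -- for which `halts_ite` charges both branches.
  refine ⟨4 + (b.cost + (2 + e.cost + 1 + 1 + 1 + 1) + 4), fun {n ε s g σ} ω hσ h3 => ?_⟩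
  let F : ℕ → ℝ := fun i =>
    if h : i < n then f (g * stepSize n ε) (ω (σ.nat 2) ⟨i, h⟩) else 0
  let I : ℕ → State → Prop := fun j τ => Memory n ε s g τ ∧ τ.nat 2 = σ.nat 2 ∧ τ.nat 3 = j ∧
    τ.real 1 0 = σ.real 1 0 + ∑ i ∈ Finset.range j, F i
  have hF : ∑ i ∈ Finset.range n, F i = ∑ i, f (g * stepSize n ε) (ω (σ.nat 2) i) := by
    rw [Finset.sum_range]
    exact Finset.sum_congr rfl fun i _ => dif_pos i.2
  refine (halts_loop (B := b.cost + (2 + e.cost + 1 + 1 + 1 + 1) + 4) I (N := n)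
    ⟨hσ, rfl, h3, by simp⟩ (fun j hj τ hτ => ?_) fun τ hτ => ?_).mono ?_ ?_
  · obtain ⟨hm, h2, h3', hr⟩ := hτ
    refine ⟨by simpa [Test.holds, NExpr.eval, hm.agents, h3'] using hj, ?_⟩
    have hi := hbe ω ⟨j, hj⟩ hm h3'
    rw [h2] at hi
    have hFj : F j = f (g * stepSize n ε) (ω (σ.nat 2) ⟨j, hj⟩) := dif_pos hj
    refine (Halts.seq (B := b.cost + (2 + e.cost + 1 + 1 + 1 + 1)) (B' := 4)
      (Q := fun υ => Memory n ε s g υ ∧ υ.nat 2 = σ.nat 2 ∧ υ.nat 3 = j ∧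
        υ.real 1 0 = σ.real 1 0 + ∑ i ∈ Finset.range (j + 1), F i) ?_ ?_)
    · refine (halts_ite (fun hb => halts_setReal ?_) (fun hb => halts_skip ?_)).mono
        (fun _ h => h) ?_
      · refine ⟨hm.setReal _, h2, h3', ?_⟩
        simp only [State.setReal, NExpr.eval, RExpr.eval, Function.update_self,
          Finset.sum_range_succ, hFj, hi.1 hb, hr]
        ring
      · exact ⟨hm, h2, h3', by rw [Finset.sum_range_succ, hFj, hi.2 hb, hr, add_zero]⟩
      · simp only [NExpr.cost, RExpr.cost]
        omega
    · rintro υ ⟨hm', h2', h3'', hr'⟩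
      refine halts_setNat ⟨hm'.setNat _ (by decide) (by decide) (by decide), ?_, ?_, hr'⟩
      · simpa [State.setNat] using h2'
      · simp [State.setNat, NExpr.eval, h3'']
  · obtain ⟨hm, h2, h3', hr⟩ := hτ
    simp [Test.holds, NExpr.eval, hm.agents, h3']
  · rintro τ ⟨hm, h2, -, hr⟩
    exact ⟨hm, h2, by rw [hr, hF]⟩
  · simp only [Test.cost, NExpr.cost]
    nlinarith

theorem halts_sumSamples (hbe : Implements b e f) : ∃ c : ℕ, ∀ {n : ℕ} {ε : ℝ} {s g : ℕ}
    {σ : State} (ω : ℕ → Fin n → AgentType), Memory n ε s g σ →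
      Halts ω (sumSamples b e) σ (fun τ => Memory n ε s g τ ∧ τ.nat 2 = sampleCount n ε ∧
        τ.real 1 0 = sampleSurplus f (sampleCount n ε) (g * stepSize n ε) ω)
        (c * (n + 1) * (sampleCount n ε + 1)) := by
  obtain ⟨c, hc⟩ := halts_sumAgents hbe
  let d := (Test.not (.leReal countExpr (.ofNat (.reg 2)))).cost
  refine ⟨2 + 3 + (d + (2 + c + 4)), fun {n ε s g σ} ω hσ => ?_⟩
  set M := sampleCount n ε
  let I : ℕ → State → Prop := fun j τ => Memory n ε s g τ ∧ τ.nat 2 = j ∧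
    τ.real 1 0 = sampleSurplus f j (g * stepSize n ε) ω
  have hloop : ∀ τ, I 0 τ → Halts ω (.loop (.not (.leReal countExpr (.ofNat (.reg 2))))
      (.seq (.setNat 3 (.const 0)) (.seq (sumAgents b e) (increment 2)))) τ (I M)
      (M * (d + (2 + (c * (n + 1) + 4))) + d) := by
    intro τ h0
    refine halts_loop I h0 (fun j hj τ hτ => ?_) fun τ hτ => ?_
    · obtain ⟨hm, h2, hr⟩ := hτ
      have hcount := hm.countExpr_le_iff ω j
      refine ⟨?_, ?_⟩
      · change ¬ countExpr.eval ω τ ≤ (τ.nat 2 : ℝ)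
        rw [h2, hcount]
        exact not_le.2 hj
      refine (halts_setNat (Q := fun υ => I j υ ∧ υ.nat 3 = 0) ⟨⟨hm.setNat _ (by decide) (by decide)
        (by decide), by simpa [State.setNat] using h2, hr⟩, ?_⟩).seq ?_
      · simp [State.setNat, NExpr.eval]
      · rintro υ ⟨⟨hm', h2', hr'⟩, h3⟩
        refine (hc ω hm' h3).seq ?_
        rintro φ ⟨hm'', h2'', hr''⟩
        refine halts_setNat ⟨hm''.setNat _ (by decide) (by decide) (by decide), ?_, ?_⟩
        · simp [State.setNat, NExpr.eval, h2'', h2']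
        · rw [sampleSurplus, Finset.sum_range_succ, ← sampleSurplus, ← hr', ← h2']
          exact hr''
    · obtain ⟨hm, h2, hr⟩ := hτ
      have hcount := hm.countExpr_le_iff ω M
      simp [Test.holds, RExpr.eval, NExpr.eval, h2, hcount, M]
  refine (((halts_setNat (Q := fun τ => Memory n ε s g τ ∧ τ.nat 2 = 0) ⟨hσ.setNat _ (by decide)
    (by decide) (by decide), by simp [State.setNat, NExpr.eval]⟩).seq fun τ hτ =>
      (halts_setReal (Q := I 0) ?_).seq hloop).mono (fun _ h => h) ?_)
  · refine ⟨hτ.1.setReal _, hτ.2, ?_⟩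
    simp [State.setReal, NExpr.eval, RExpr.eval, sampleSurplus]
  · simp only [NExpr.cost, RExpr.cost]
    have h₁ : M * (d + (2 + (c * (n + 1) + 4))) ≤ M * ((d + (2 + c + 4)) * (n + 1)) :=
      Nat.mul_le_mul_left _ (by nlinarith)
    nlinarith [Nat.zero_le (d * n * M), Nat.zero_le (d * n), Nat.zero_le (c * n * M),
      Nat.zero_le (c * n), Nat.zero_le (n * M)]

/-- The surplus of a profile never exceeds `n`, so every candidate of size at least `n` passes the
comparison. -/
theorem IsSurplus.exists_isFirst (hf : IsSurplus f) {n : ℕ} {δ : ℝ} (hδ : 0 < δ) (M : ℕ)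
    (ω : ℕ → Fin n → AgentType) : ∃ g, IsFirst f M δ ω g ∧ g ≤ ⌈n / δ⌉₊ := by
  classical
  have h : sampleSurplus f M (⌈n / δ⌉₊ * δ) ω ≤ M * (⌈n / δ⌉₊ * δ) := by
    refine (hf.sampleSurplus_le M (by positivity) ω).trans ?_
    gcongr
    exact (div_le_iff₀ hδ).1 (Nat.le_ceil _)
  have hex : ∃ g : ℕ, sampleSurplus f M (g * δ) ω ≤ M * (g * δ) := ⟨_, h⟩
  exact ⟨Nat.find hex, ⟨Nat.find_spec hex, fun j hj => Nat.find_min hex hj⟩, Nat.find_min' hex h⟩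

/-- A bound for the running time, up to a constant factor. -/
def timeBound (n : ℕ) (ε : ℝ) : ℕ :=
  (n + 1) * (sampleCount n ε + 1) * (⌈n / stepSize n ε⌉₊ + 1)

theorem one_le_timeBound (n : ℕ) (ε : ℝ) : 1 ≤ timeBound n ε :=
  Nat.mul_pos (Nat.mul_pos n.succ_pos (Nat.succ_pos _)) (Nat.succ_pos _)

/-- The empirical surplus is evaluated once per candidate, hence at most `⌈n / stepSize n ε⌉₊ + 1`
times. The old candidate `g` is arbitrary and `s` is preserved, so that a second search can follow a
first one. -/
theorem halts_search (hf : IsSurplus f) (hbe : Implements b e f) : ∃ c : ℕ, ∀ {n : ℕ} {ε : ℝ}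
    {s g : ℕ} {σ : State} (ω : ℕ → Fin n → AgentType), 0 < ε → Memory n ε s g σ →
      ∃ g', IsFirst f (sampleCount n ε) (stepSize n ε) ω g' ∧
        Halts ω (search b e) σ (Memory n ε s g') (c * timeBound n ε) := by
  obtain ⟨c, hc⟩ := halts_sumSamples hbe
  let d := (Test.not (.leReal (.arr 1 (.const 0)) (.mul (.ofNat (.reg 2)) (candidateExpr 1)))).cost
  refine ⟨2 + c + (d + (4 + c)), fun {n ε s g₀ σ} ω hε hσ => ?_⟩
  obtain ⟨G, hG, hGle⟩ := hf.exists_isFirst (stepSize_pos n hε) (sampleCount n ε) ω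
  refine ⟨G, hG, ?_⟩
  set M := sampleCount n ε
  let I : ℕ → State → Prop := fun g τ => Memory n ε s g τ ∧ τ.nat 2 = M ∧
    τ.real 1 0 = sampleSurplus f M (g * stepSize n ε) ω
  have hset : ∀ {g g' : ℕ} {τ : State}, Memory n ε s g τ → Memory n ε s g' (τ.setNat 1 g') :=
    fun h => ⟨by simpa [State.setNat] using h.agents, h.eps, by simpa [State.setNat] using h.saved,
      by simp [State.setNat]⟩
  -- Each pass over the samples leaves their number in register 2, so the comparison of the average
  -- with the candidate becomes one of the sum with a product.
  have htest : ∀ g τ, I g τ → ((Test.not (.leReal (.arr 1 (.const 0))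
      (.mul (.ofNat (.reg 2)) (candidateExpr 1)))).holds ω τ ↔
        ¬ sampleSurplus f M (g * stepSize n ε) ω ≤ M * (g * stepSize n ε)) := by
    rintro g τ ⟨hm, h2, hr⟩
    simp [Test.holds, RExpr.eval, NExpr.eval, hm.eval_candidateExpr, h2, hr, hm.candidate]
  refine ((halts_setNat (Q := Memory n ε s 0) (hset hσ)).seq fun τ hτ => (hc ω hτ).seq
    fun τ hτ => (halts_loop I hτ (N := G) (B := 4 + c * (n + 1) * (M + 1))
      (fun j hj τ hτ => ⟨(htest j τ hτ).2 (hG.2 j hj), ?_⟩)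
      fun τ hτ => by rw [htest G τ hτ, not_not]; exact hG.1)).mono (fun _ h => h.1) ?_
  · refine (halts_setNat (Q := Memory n ε s (j + 1)) ?_).seq fun τ hτ => hc ω hτ
    have : (NExpr.add (.reg 1) (.const 1)).eval τ = j + 1 := by
      simp [NExpr.eval, hτ.1.candidate]
    rw [this]
    exact hset hτ.1
  · change 2 + (c * (n + 1) * (M + 1) + (G * (d + (4 + c * (n + 1) * (M + 1))) + d)) ≤ _
    have hA : 1 ≤ (n + 1) * (M + 1) := Nat.mul_pos n.succ_pos M.succ_pos
    unfold timeBound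
    change _ ≤ (2 + c + (d + (4 + c))) * ((n + 1) * (M + 1) * (⌈n / stepSize n ε⌉₊ + 1))
    rw [mul_assoc c]
    generalize (n + 1) * (M + 1) = A at hA ⊢
    generalize ⌈n / stepSize n ε⌉₊ = H at hGle ⊢
    calc 2 + (c * A + (G * (d + (4 + c * A)) + d))
        ≤ 2 * A + (c * A + (H * (d * A + (4 * A + c * A)) + d * A)) := by
          gcongr <;> nlinarith
      _ ≤ (2 + c + (d + (4 + c))) * (A * (H + 1)) := by
          nlinarith [Nat.zero_le (A * H), Nat.zero_le (c * A * H), Nat.zero_le (c * A)]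

end search

/-! ### Polynomial running time -/

theorem timeBound_le (n : ℕ) {ε : ℝ} (hε : 0 < ε) :
    (timeBound n ε : ℝ) ≤ 660 * ((n : ℝ) + 1 / ε + 1) ^ 11 := by
  set X : ℝ := (n : ℝ) + 1 / ε + 1
  have he : 0 < 1 / ε := by positivity
  have hn : (0 : ℝ) ≤ n := n.cast_nonneg
  have hX : 1 ≤ X := by simp only [X]; linarith
  have hn1 : (n : ℝ) + 1 ≤ X := by simp only [X]; linarith
  have heX : 1 / ε ≤ X := by simp only [X]; linarith
  have h₁ : ((sampleCount n ε : ℕ) : ℝ) + 1 ≤ 66 * X ^ 7 := by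
    have hc := (Nat.ceil_lt_add_one (a := 64 * ((n + 1 : ℝ) * (n + 1)) * ((n + 1) * (n + 1)) /
      (ε * ε * ε)) (by positivity)).le
    have hp : 64 * ((n + 1 : ℝ) * (n + 1)) * ((n + 1) * (n + 1)) / (ε * ε * ε) ≤ 64 * X ^ 7 :=
      calc _ = 64 * (((n : ℝ) + 1) ^ 4 * (1 / ε) ^ 3) := by field_simp
        _ ≤ 64 * (X ^ 4 * X ^ 3) := by gcongr
        _ = _ := by ring
    have := one_le_pow₀ hX (n := 7)
    unfold sampleCount
    linarith
  have h₂ : ((⌈n / stepSize n ε⌉₊ : ℕ) : ℝ) + 1 ≤ 10 * X ^ 3 := by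
    have hc := (Nat.ceil_lt_add_one (a := n / stepSize n ε)
      (div_nonneg hn (stepSize_pos n hε).le)).le
    have hp : n / stepSize n ε ≤ 8 * X ^ 3 :=
      calc _ = 8 * (n * (n + 1) * (1 / ε)) := by unfold stepSize; field_simp
        _ ≤ 8 * (X * X * X) := by gcongr; linarith
        _ = _ := by ring
    have := one_le_pow₀ hX (n := 3)
    linarith
  unfold timeBound
  push_cast
  -- One factor each for agents, samples and candidates: `11 = 1 + 7 + 3` and `660 = 66 * 10`.
  calc _ ≤ X * (66 * X ^ 7) * (10 * X ^ 3) := by gcongr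
    _ = _ := by ring

theorem polyTime_of_halts {P : Program} (c : ℕ) (h : ∀ (n : ℕ) (ε : ℝ), 0 < ε →
    ∀ ω : ℕ → Fin n → AgentType, ∃ Q, Halts ω P (initial n ε) Q (c * timeBound n ε)) :
    PolyTime P := by
  refine ⟨c * 660, 11, fun n ε hε ω => ?_⟩
  obtain ⟨Q, τ, T, h₁, -, h₂⟩ := h n ε hε ω
  refine ⟨τ, T, h₁, ?_⟩
  calc (T : ℝ) ≤ c * timeBound n ε := by exact_mod_cast h₂
    _ ≤ c * (660 * ((n : ℝ) + 1 / ε + 1) ^ 11) := by gcongr; exact timeBound_le n hε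
    _ = _ := by push_cast; ring

theorem memory_initial (n : ℕ) (ε : ℝ) : Memory n ε 0 0 (initial n ε) := by
  constructor <;> simp [initial]

/-! ## The surplus functions as programs -/

/-- The value of the current agent in the current sample. -/
def valueExpr : RExpr := .sampleValue (.reg 2) (.reg 3)

/-- The size of the current agent in the current sample. -/
def sizeExpr : RExpr := .sampleSize (.reg 2) (.reg 3)

/-- The payment of a small agent. -/
def paymentExpr : RExpr := .mul (.mul (.const 2) (candidateExpr 1)) sizeExpr

/-- Whether the current agent is small and her surplus is not negative. -/
def smallTest : Test := .and (.leReal sizeExpr (.const (1 / 2))) (.leReal paymentExpr valueExpr)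

/-- Whether the current agent is large and her surplus is not negative. -/
def largeTest : Test :=
  .and (.and (.not (.leReal sizeExpr (.const (1 / 2)))) (.leReal sizeExpr (.const 1)))
    (.leReal (candidateExpr 1) valueExpr)

theorem implements_smallSurplus : Implements smallTest (.sub valueExpr paymentExpr) smallSurplus := by
  intro n ε s g σ ω i hσ h3
  have hv : valueExpr.eval ω σ = (ω (σ.nat 2) i).1 := by
    simp [valueExpr, RExpr.eval, NExpr.eval, h3]
  have hs : sizeExpr.eval ω σ = (ω (σ.nat 2) i).2 := by
    simp [sizeExpr, RExpr.eval, NExpr.eval, h3]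
  have hp : paymentExpr.eval ω σ = 2 * (g * stepSize n ε) * (ω (σ.nat 2) i).2 := by
    simp [paymentExpr, RExpr.eval, hs, hσ.eval_candidateExpr, hσ.candidate]
  have hle : ((ω (σ.nat 2) i).2 : ℝ) ≤ ((1 / 2 : ℚ) : ℝ) ↔ (ω (σ.nat 2) i).2 ≤ 1 / 2 := by
    rw [← NNReal.coe_le_coe]
    norm_num
  simp only [smallTest, Test.holds, RExpr.eval, hv, hs, hp, hle, smallSurplus]
  constructor
  · rintro ⟨h₁, h₂⟩
    rw [if_pos h₁, max_eq_left (sub_nonneg.2 h₂)]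
  · intro h
    split_ifs with h₁
    · exact max_eq_right (sub_nonpos.2 (not_le.1 fun h₂ => h ⟨h₁, h₂⟩).le)
    · rfl

theorem implements_largeSurplus :
    Implements largeTest (.sub valueExpr (candidateExpr 1)) largeSurplus := by
  intro n ε s g σ ω i hσ h3
  have hv : valueExpr.eval ω σ = (ω (σ.nat 2) i).1 := by
    simp [valueExpr, RExpr.eval, NExpr.eval, h3]
  have hs : sizeExpr.eval ω σ = (ω (σ.nat 2) i).2 := by
    simp [sizeExpr, RExpr.eval, NExpr.eval, h3]
  have hle : ((ω (σ.nat 2) i).2 : ℝ) ≤ ((1 / 2 : ℚ) : ℝ) ↔ (ω (σ.nat 2) i).2 ≤ 1 / 2 := by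
    rw [← NNReal.coe_le_coe]
    norm_num
  have hle1 : ((ω (σ.nat 2) i).2 : ℝ) ≤ ((1 : ℚ) : ℝ) ↔ (ω (σ.nat 2) i).2 ≤ 1 := by
    rw [← NNReal.coe_le_coe]
    norm_num
  simp only [largeTest, Test.holds, RExpr.eval, hv, hs, hle, hle1, hσ.eval_candidateExpr,
    hσ.candidate, largeSurplus]
  constructor
  · rintro ⟨h₁, h₂⟩
    rw [if_pos h₁, max_eq_left (sub_nonneg.2 h₂)]
  · intro h
    split_ifs with h₁
    · exact max_eq_right (sub_nonpos.2 (not_le.1 fun h₂ => h ⟨h₁, h₂⟩).le)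
    · rfl

/-- The search for a per-unit price. -/
def smallSearch : Program := search smallTest (.sub valueExpr paymentExpr)

/-- The search for a take-it-or-leave-it price. -/
def largeSearch : Program := search largeTest (.sub valueExpr (candidateExpr 1))

/-- Outputs a per-unit price. -/
def perUnitProgram : Program :=
  .seq smallSearch (.setReal 0 (.const 0) (.mul (.const 2) (candidateExpr 1)))

/-- Outputs a per-unit price or a take-it-or-leave-it price. -/
def mechanismProgram : Program :=
  .seq smallSearch (.seq (.setNat 4 (.reg 1)) (.seq largeSearch
    (.ite (.leNat (.reg 1) (.reg 4))
      (.seq (.setReal 0 (.const 0) (.mul (.const 2) (candidateExpr 4))) (.setNat 0 (.const 0)))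
      (.seq (.setReal 0 (.const 0) (candidateExpr 1)) (.setNat 0 (.const 1))))))

theorem halts_perUnitProgram : ∃ c : ℕ, ∀ (n : ℕ) (ε : ℝ), 0 < ε → ∀ ω : ℕ → Fin n → AgentType,
    ∃ g, IsFirst smallSurplus (sampleCount n ε) (stepSize n ε) ω g ∧
      Halts ω perUnitProgram (initial n ε) (fun τ => τ.real 0 0 = 2 * (g * stepSize n ε))
        (c * timeBound n ε) := by
  obtain ⟨c, hc⟩ := halts_search isSurplus_smallSurplus implements_smallSurplus
  refine ⟨c + 100, fun n ε hε ω => ?_⟩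
  obtain ⟨g, hg, h⟩ := hc ω hε (memory_initial n ε)
  refine ⟨g, hg, (h.seq fun τ hτ => halts_setReal ?_).mono (fun _ h => h) ?_⟩
  · simp [State.setReal, NExpr.eval, RExpr.eval, hτ.eval_candidateExpr, hτ.candidate]
  · rw [add_mul]
    gcongr
    exact (show _ ≤ 100 by decide).trans (Nat.le_mul_of_pos_right _ (one_le_timeBound n ε))

theorem halts_mechanismProgram : ∃ c : ℕ, ∀ (n : ℕ) (ε : ℝ), 0 < ε →
    ∀ ω : ℕ → Fin n → AgentType, ∃ g g',
      IsFirst smallSurplus (sampleCount n ε) (stepSize n ε) ω g ∧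
      IsFirst largeSurplus (sampleCount n ε) (stepSize n ε) ω g' ∧
      Halts ω mechanismProgram (initial n ε) (fun τ =>
        g' ≤ g ∧ τ.nat 0 = 0 ∧ τ.real 0 0 = 2 * (g * stepSize n ε) ∨
        g ≤ g' ∧ τ.nat 0 = 1 ∧ τ.real 0 0 = g' * stepSize n ε) (c * timeBound n ε) := by
  obtain ⟨c, hc⟩ := halts_search isSurplus_smallSurplus implements_smallSurplus
  obtain ⟨c', hc'⟩ := halts_search isSurplus_largeSurplus implements_largeSurplus
  refine ⟨c + c' + 300, fun n ε hε ω => ?_⟩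
  obtain ⟨g, hg, h⟩ := hc ω hε (memory_initial n ε)
  obtain ⟨g', hg'⟩ := isSurplus_largeSurplus.exists_isFirst (stepSize_pos n hε)
    (sampleCount n ε) ω
  have hlarge : ∀ {σ : State}, Memory n ε g g σ →
      Halts ω largeSearch σ (Memory n ε g g') (c' * timeBound n ε) := by
    intro σ hσ
    obtain ⟨k, hk, hh⟩ := hc' ω hε hσ
    -- The first accepted candidate depends on the samples only, so it can be fixed before the state
    -- in which the second search starts is known.
    obtain rfl : k = g' := by
      by_contra hne
      rcases lt_or_gt_of_ne hne with hlt | hlt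
      · exact hg'.1.2 _ hlt hk.1
      · exact hk.2 _ hlt hg'.1.1
    exact hh
  refine ⟨g, g', hg, hg'.1, (h.seq fun τ hτ => (halts_setNat (Q := Memory n ε g g) ?_).seq
    fun τ hτ => (hlarge hτ).seq fun τ hτ => halts_ite (B := 100) (B' := 100) (fun hb => ?_)
      fun hb => ?_).mono (fun _ h => h) ?_⟩
  · exact ⟨by simpa [State.setNat] using hτ.agents, hτ.eps,
      by simp [State.setNat, NExpr.eval, hτ.candidate],
      by simpa [State.setNat] using hτ.candidate⟩
  -- The price must be written before register 0: the candidate is computed from `n` and `ε`, which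
  -- the two outputs overwrite.
  · refine ((halts_setReal (Q := fun υ => υ.real 0 0 = 2 * (g * stepSize n ε)) ?_).seq
      fun υ hυ => halts_setNat (Or.inl ⟨?_, ?_, hυ⟩)).mono (fun _ h => h) (by decide)
    · simp [State.setReal, NExpr.eval, RExpr.eval, hτ.eval_candidateExpr, hτ.saved]
    · simpa [Test.holds, NExpr.eval, hτ.candidate, hτ.saved] using hb
    · simp [State.setNat, NExpr.eval]
  · refine ((halts_setReal (Q := fun υ => υ.real 0 0 = g' * stepSize n ε) ?_).seq
      fun υ hυ => halts_setNat (Or.inr ⟨?_, ?_, hυ⟩)).mono (fun _ h => h) (by decide)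
    · simp [State.setReal, NExpr.eval, hτ.eval_candidateExpr, hτ.candidate]
    · simp only [Test.holds, NExpr.eval, hτ.candidate, hτ.saved] at hb
      exact (not_le.1 hb).le
    · simp [State.setNat, NExpr.eval]
  · have h₁ := one_le_timeBound n ε
    have h₂ : 300 ≤ 300 * timeBound n ε := Nat.le_mul_of_pos_right _ h₁
    rw [add_mul, add_mul]
    simp only [Test.cost, NExpr.cost]
    omega

/-! ## Price guarantees -/

section guarantees

variable {n : ℕ} (D : Fin n → Measure AgentType) [∀ i, IsProbabilityMeasure (D i)]

theorem exists_perUnit_guarantee (hD : ∀ i, ∀ᵐ t ∂(D i), t.2 ≤ 1 / 2) :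
    ∃ q : ℝ≥0, GuaranteesWelfare D (perUnit n q) (expectedOpt D / 3) := by
  obtain ⟨u, hu, hfix⟩ := isSurplus_smallSurplus.exists_expectedSurplus_eq D
  refine ⟨⟨2 * u, by positivity⟩, (guaranteesWelfare_perUnit D hu rfl).mono ?_⟩
  have := expectedOpt_le_of_small D hD hu
  rw [hfix] at this ⊢
  rw [min_self]
  linarith

/-- `OPT ≤ 3u + 2w ≤ 5 max(u, w)`, and the kind of mechanism is chosen by the larger fixed point. -/
theorem exists_mechanism_guarantee : ∃ q r : ℝ≥0,
    GuaranteesWelfare D (perUnit n q) (expectedOpt D / 5) ∨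
      GuaranteesWelfare D (takeItOrLeaveIt n r) (expectedOpt D / 5) := by
  obtain ⟨u, hu, hfix⟩ := isSurplus_smallSurplus.exists_expectedSurplus_eq D
  obtain ⟨w, hw, hfix'⟩ := isSurplus_largeSurplus.exists_expectedSurplus_eq D
  have hopt := expectedOpt_le D hu hw
  rw [hfix, hfix'] at hopt
  refine ⟨⟨2 * u, by positivity⟩, ⟨w, hw⟩, ?_⟩
  rcases le_total w u with h | h
  · refine Or.inl ((guaranteesWelfare_perUnit D hu rfl).mono ?_)
    rw [hfix, min_self]
    linarith
  · refine Or.inr ((guaranteesWelfare_takeItOrLeaveIt D hw rfl).mono ?_)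
    rw [hfix', min_self]
    linarith

/-- The cubic dependence of `sampleCount` on `1 / ε` is calibrated here: two factors cancel the
squared step size, one gives the failure probability. The half leaves room for a union bound over
two searches. -/
theorem IsSurplus.measure_not_separates_le_half {f : ℝ → AgentType → ℝ} (hf : IsSurplus f)
    {u : ℝ} (hu : 0 ≤ u) (hfix : expectedSurplus D f u = u) {ε : ℝ} (hε : 0 < ε) :
    sampleLaw D {ω | ¬ Separates f (sampleCount n ε) u (stepSize n ε) ω} ≤
      ENNReal.ofReal (ε / 2) := by
  refine (hf.measure_not_separates_le D hu hfix (sampleCount_pos n hε) (stepSize_pos n hε)).trans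
    (ENNReal.ofReal_le_ofReal ?_)
  have hM : 64 * ((n + 1 : ℝ) * (n + 1)) * ((n + 1) * (n + 1)) / (ε * ε * ε) ≤
      (sampleCount n ε : ℝ) := Nat.le_ceil _
  have hn : (0 : ℝ) ≤ n := n.cast_nonneg
  calc (n : ℝ) ^ 2 / (2 * sampleCount n ε * stepSize n ε ^ 2)
      ≤ (n + 1) ^ 2 / (2 * (64 * ((n + 1 : ℝ) * (n + 1)) * ((n + 1) * (n + 1)) / (ε * ε * ε)) *
          stepSize n ε ^ 2) := by
        have := stepSize_pos n hε
        gcongr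
        linarith
    _ = ε / 2 := by
        unfold stepSize
        field_simp
        norm_num

theorem outputsWhp_perUnitProgram {ε : ℝ} (hε : 0 < ε) (hD : ∀ i, ∀ᵐ t ∂(D i), t.2 ≤ 1 / 2) :
    OutputsWhp perUnitProgram D ε (fun τ =>
      GuaranteesWelfare D (perUnit n τ.price) (expectedOpt D / 3 - ε)) := by
  obtain ⟨u, hu, hfix⟩ := isSurplus_smallSurplus.exists_expectedSurplus_eq D
  obtain ⟨c, hc⟩ := halts_perUnitProgram
  have hδ := stepSize_pos n hε
  refine outputsWhp_of_halts
    ((isSurplus_smallSurplus.measure_not_separates_le_half D hu hfix hε).trans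
      (ENNReal.ofReal_le_ofReal (half_le_self hε.le))) fun ω hω => ?_
  obtain ⟨g, hg, h⟩ := hc n ε hε ω
  refine ⟨_, h.mono (fun τ hτ => ?_) le_rfl⟩
  have hy : 0 ≤ g * stepSize n ε := by positivity
  have hmin := isSurplus_smallSurplus.sub_le_min D hu hfix hy
    ((not_not.1 hω : Separates _ _ _ _ _).abs_sub_le hu hδ hg)
  have hopt := expectedOpt_le_of_small D hD hu
  -- The price error is at most two steps, and `sub_le_min` multiplies it by `n + 1`.
  have he : (n + 1) * (2 * stepSize n ε) = ε / 4 := by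
    unfold stepSize
    field_simp
    norm_num
  refine (guaranteesWelfare_perUnit D hy ?_).mono (le_trans ?_ hmin)
  · rw [State.price, hτ, Real.coe_toNNReal _ (by positivity)]
  · rw [he]
    linarith

theorem outputsWhp_mechanismProgram {ε : ℝ} (hε : 0 < ε) :
    OutputsWhp mechanismProgram D ε (fun τ =>
      GuaranteesWelfare D (τ.mechanism n) (expectedOpt D / 5 - ε)) := by
  obtain ⟨u, hu, hfix⟩ := isSurplus_smallSurplus.exists_expectedSurplus_eq D
  obtain ⟨w, hw, hfix'⟩ := isSurplus_largeSurplus.exists_expectedSurplus_eq D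
  obtain ⟨c, hc⟩ := halts_mechanismProgram
  have hδ := stepSize_pos n hε
  have hbad := (measure_union_le _ _).trans
    (add_le_add (isSurplus_smallSurplus.measure_not_separates_le_half D hu hfix hε)
      (isSurplus_largeSurplus.measure_not_separates_le_half D hw hfix' hε))
  rw [← ENNReal.ofReal_add (by positivity) (by positivity), add_halves] at hbad
  refine outputsWhp_of_halts hbad fun ω hω => ?_
  simp only [Set.mem_union, Set.mem_ofPred_eq, not_or, not_not] at hω
  obtain ⟨g, g', hg, hg', h⟩ := hc n ε hε ω
  refine ⟨_, h.mono (fun τ hτ => ?_) le_rfl⟩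
  have hy : 0 ≤ g * stepSize n ε := by positivity
  have hz : 0 ≤ g' * stepSize n ε := by positivity
  have hgu := hω.1.abs_sub_le hu hδ hg
  have hgw := hω.2.abs_sub_le hw hδ hg'
  have hmin := isSurplus_smallSurplus.sub_le_min D hu hfix hy hgu
  have hmin' := isSurplus_largeSurplus.sub_le_min D hw hfix' hz hgw
  have hopt := expectedOpt_le D hu hw
  rw [hfix, hfix'] at hopt
  have he : (n + 1) * (2 * stepSize n ε) = ε / 4 := by
    unfold stepSize
    field_simp
    norm_num
  have he' : 2 * stepSize n ε ≤ ε / 4 := by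
    rw [← he]
    exact le_mul_of_one_le_left (by positivity) (by linarith [(n.cast_nonneg : (0 : ℝ) ≤ n)])
  rw [he] at hmin hmin'
  rw [abs_le] at hgu hgw
  rcases hτ with ⟨hle, h0, hτ⟩ | ⟨hle, h1, hτ⟩
  · have hle' : g' * stepSize n ε ≤ g * stepSize n ε := by gcongr
    rw [State.mechanism, if_pos h0]
    refine (guaranteesWelfare_perUnit D hy ?_).mono (le_trans ?_ hmin)
    · rw [State.price, hτ, Real.coe_toNNReal _ (by positivity)]
    · linarith
  · have hle' : g * stepSize n ε ≤ g' * stepSize n ε := by gcongr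
    rw [State.mechanism, if_neg (by simp [h1])]
    refine (guaranteesWelfare_takeItOrLeaveIt D hz ?_).mono (le_trans ?_ hmin')
    · rw [State.price, hτ, Real.coe_toNNReal _ (by positivity)]
    · linarith

end guarantees

/-! ### Assembling the parts of the theorem -/

theorem polyTime_perUnitProgram : PolyTime perUnitProgram := by
  obtain ⟨c, hc⟩ := halts_perUnitProgram
  refine polyTime_of_halts c fun n ε hε ω => ?_
  obtain ⟨g, -, h⟩ := hc n ε hε ω
  exact ⟨_, h⟩

theorem polyTime_mechanismProgram : PolyTime mechanismProgram := by
  obtain ⟨c, hc⟩ := halts_mechanismProgram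
  refine polyTime_of_halts c fun n ε hε ω => ?_
  obtain ⟨g, g', -, -, h⟩ := hc n ε hε ω
  exact ⟨_, h⟩

theorem isBalancedCollection_perUnit {n : ℕ} {α β c : ℝ} (hc : 0 ≤ c) (hα : 1 / α = c / 2)
    (hβ : β = c) {alg : (Fin n → AgentType) → Fin n → ℝ≥0} (halg : ∀ t, alg t ∈ feasible n (1 / 2))
    {q : (Fin n → AgentType) → ℝ≥0} (hq : ∀ t, (q t : ℝ) = c * welfare t (alg t)) :
    IsBalancedCollection α β (feasible n (1 / 2)) value (fun t => perUnit n (q t)) alg :=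
  ⟨exchangeFamily n, exchangeCompatible_exchangeFamily, fun t ρ =>
    isBalanced_perUnit hc hα hβ t (halg t) (hq t) ρ⟩

end Knapsack

end

open Knapsack in
theorem theorem1p2 :
    -- balancedness of per-unit prices
    (∀ (n : ℕ) (alg : (Fin n → AgentType) → Fin n → ℝ≥0),
      (∀ t, alg t ∈ feasible n (1 / 2)) →
        IsBalancedCollection 2 1 (feasible n (1 / 2)) value
          (fun t => perUnit n (welfare t (alg t)).toNNReal) alg ∧
        IsBalancedCollection 1 2 (feasible n (1 / 2)) value
          (fun t => perUnit n (2 * (welfare t (alg t)).toNNReal)) alg) ∧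
    -- existence of a per-unit price if no demand exceeds half of the capacity
    (∀ (n : ℕ) (D : Fin n → Measure AgentType) [∀ i, IsProbabilityMeasure (D i)],
      (∀ i, ∀ᵐ t ∂(D i), t.2 ≤ 1 / 2) →
        ∃ q : ℝ≥0, GuaranteesWelfare D (perUnit n q) (expectedOpt D / 3)) ∧
    -- existence for arbitrary demands
    (∀ (n : ℕ) (D : Fin n → Measure AgentType) [∀ i, IsProbabilityMeasure (D i)],
      ∃ q r : ℝ≥0,
        GuaranteesWelfare D (perUnit n q) (expectedOpt D / 5) ∨
        GuaranteesWelfare D (takeItOrLeaveIt n r) (expectedOpt D / 5)) ∧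
    -- computation if no demand exceeds half of the capacity
    (∃ P : Program, PolyTime P ∧
      ∀ (n : ℕ) (ε : ℝ), 0 < ε →
        ∀ (D : Fin n → Measure AgentType) [∀ i, IsProbabilityMeasure (D i)],
          (∀ i, ∀ᵐ t ∂(D i), t.2 ≤ 1 / 2) →
            OutputsWhp P D ε (fun τ =>
              GuaranteesWelfare D (perUnit n τ.price) (expectedOpt D / 3 - ε))) ∧
    -- computation for arbitrary demands
    (∃ P : Program, PolyTime P ∧
      ∀ (n : ℕ) (ε : ℝ), 0 < ε →
        ∀ (D : Fin n → Measure AgentType) [∀ i, IsProbabilityMeasure (D i)],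
          OutputsWhp P D ε (fun τ =>
            GuaranteesWelfare D (τ.mechanism n) (expectedOpt D / 5 - ε))) := by
  refine ⟨fun n alg halg => ⟨?_, ?_⟩, fun n D _ hD => exists_perUnit_guarantee D hD,
    fun n D _ => exists_mechanism_guarantee D,
    ⟨perUnitProgram, polyTime_perUnitProgram, fun n ε hε D _ hD =>
      outputsWhp_perUnitProgram D hε hD⟩,
    ⟨mechanismProgram, polyTime_mechanismProgram, fun n ε hε D _ =>
      outputsWhp_mechanismProgram D hε⟩⟩
  all_goals have h0 : ∀ t, 0 ≤ welfare t (alg t) := fun t => totalValue_nonneg t _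
  · exact isBalancedCollection_perUnit (c := 1) zero_le_one rfl rfl halg fun t => by
      rw [Real.coe_toNNReal _ (h0 t), one_mul]
  · exact isBalancedCollection_perUnit (c := 2) zero_le_two (by norm_num) rfl halg fun t => by
      rw [NNReal.coe_mul, Real.coe_toNNReal _ (h0 t), NNReal.coe_ofNat]
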